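/- **Expander walks are two-step tensorial.** There exist universal constants $c' > 0$ and $C' > 0$ such that the following holds. *Graphs and walks.* Let $G$ be a finite nonempty undirected graph on a vertex set $V$ with nonnegative symmetric edge weights (self-loops allowed, no isolated vertices). For $k \ge 1$ let $W_G(k)$ be the collection of walks $w=(w_1,\dots,w_k)$ with $k$ vertices in $G$, with the distribution $\Pi_k$ in which $w_1$ is drawn from the stationary distribution of the random walk on $G$ (proportional to the weighted degree) and $w_2,\dots,w_k$ are obtained by $k-1$ steps of this random walk. If $1=\lambda_1\ge\lambda_2\ge\dots\ge\lambda_n$ are the eigenvalues of the normalized random walk operator of $G$, then $G$ is a $\gamma$-two-sided expander if $|\lambda_i|\le\gamma$ for all $i\ge 2$. *Ensembles.* A $t$-local PSD ensemble $\mathbf Z=\{\mathbf Z_v\}_{v\in V}$ over a finite alphabet $\Sigma$ consists of probability distributions $\{\mathbf Z_S\}$ on $\Sigma^S$ for all $S\subseteq V$ with $|S|\le t$, consistent under restriction to subsets, such that for every $T \subseteq V$ with $|T|\le t-2$ and every $\xi\in\Sigma^T$ with $\Pr[\mathbf Z_T=\xi]>0$ the conditional covariance matrix of the indicators $\mathbf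 1[\mathbf Z_S=\alpha]$, $|S|\le (t-|T|)/2$, $\alpha\in\Sigma^S$, given $\mathbf Z_T=\xi$, is positive semidefinite. For a tuple $w$ of vertices, $\{\mathbf Z_w\}$ is the joint distribution of $(\mathbf Z_{w_1},\dots,\mathbf Z_{w_k})$ on $\Sigma^k$. *Propagation rounding.* Given $L\ge k$ and an $(L+2k)$-local PSD ensemble $\mathbf Z$: choose $m\in\{1,\dots,\lfloor L/k\rfloor\}$ uniformly, sample $m$ independent walks from $\Pi_k$, let $S$ be the set of all their vertices, sample $\sigma\sim\{\mathbf Z_S\}$, and let $\mathbf Z'$ be $\mathbf Z$ conditioned on $\mathbf Z_S=\sigma$. Write $\mathbb E_\Omega$ for the expectation over $(m,S,\sigma)$. *Claim.* Let $k,q,L\in\mathbb N$ with $k\ge1$, let $\mu\in(0,1]$, and suppose that $$L\ \ge\ c'\cdot\frac{q^{4k}\,k^7}{\mu^5}$$ and that $G$ is a $\gamma$-two-sided expander with $$\gamma\ \le\ C'\cdot\frac{\mu^2}{k^2\,q^{2k}}.$$ Then $W_G(k)$ is $(\mu,L)$-two-step tensorial: for every $(L+2k)$-local PSD ensemble $\mathbf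 Z$ on $V$ with $|\mathrm{supp}(\mathbf Z_v)|\le q$ for all $v\in V$, we have $L\ge k$, $$\mathbb E_\Omega\ \mathbb E_{w\sim\Pi_k}\bigl\|\{\mathbf Z'_w\}-\{\mathbf Z'_{w_1}\}\cdots\{\mathbf Z'_{w_k}\}\bigr\|_1\le\mu,$$ and $$\mathbb E_\Omega\ \mathbb E_{s,t\sim\Pi_k}\bigl\|\{\mathbf Z'_s\mathbf Z'_t\}-\{\mathbf Z'_s\}\{\mathbf Z'_t\}\bigr\|_1\le\mu,$$ where $s,t$ are independent and $\|\cdot\|_1$ is the $\ell_1$ norm (sum of absolute values). -/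

import Mathlib

/-! ### Weighted graphs, walk distributions, two-sided expansion -/

/-- A finite undirected graph with nonnegative edge weights (a pair of weight `0` is a non-edge,
self-loops are allowed) and no isolated vertex. An unweighted graph has weights `0` and `1`;
multigraphs are covered by integer weights. -/
structure WeightedGraph (V : Type) [Fintype V] where
  weight : V → V → ℝ
  weight_symm : ∀ u v, weight u v = weight v u
  weight_nonneg : ∀ u v, 0 ≤ weight u v
  exists_weight_pos : ∀ u, ∃ v, 0 < weight u v

namespace WeightedGraph

variable {V : Type} [Fintype V] (G : WeightedGraph V)

/-- The weighted degree. -/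
noncomputable def deg (v : V) : ℝ := ∑ u, G.weight v u

/-- The transition probability of the random walk from `u` to `v`. -/
noncomputable def step (u v : V) : ℝ := G.weight u v / G.deg u

/-- The stationary distribution of the random walk. -/
noncomputable def stationary (v : V) : ℝ := G.deg v / ∑ u, G.deg u

/-- The distribution `Π_k` on tuples `(w_1, …, w_k)`: `w_1` is stationary, followed by `k - 1`
steps of the random walk. It is supported on the collection `W_G(k)` of walks
(with `k` vertices) in `G`. -/
noncomputable def walkDist : (k : ℕ) → (Fin k → V) → ℝ
  | 0, _ => 1
  | l + 1, w => G.stationary (w 0) * ∏ i : Fin l, G.step (w i.castSucc) (w i.succ)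

/-- The normalized random walk operator of `G` in its symmetric form `D^{-1/2} W D^{-1/2}`. It is
the matrix of the walk operator `D^{-1} W` in the orthonormal basis of rescaled point masses
of `L²(stationary)`, hence has the same eigenvalues. -/
noncomputable def normAdj : Matrix V V ℝ :=
  Matrix.of fun u v => G.weight u v / (√(G.deg u) * √(G.deg v))

theorem normAdj_isHermitian : G.normAdj.IsHermitian := by
  ext u v
  simp [normAdj, G.weight_symm u v, mul_comm]

/-- `G` is a `γ`-two-sided expander: if `λ_1 ≥ λ_2 ≥ … ≥ λ_n` are the eigenvalues (with
multiplicity) of the normalized random walk operator, so that `λ_1 = 1`, then `|λ_i| ≤ γ` for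
all `i ≥ 2`. (`eigenvalues₀` lists the eigenvalues in decreasing order, starting at index `0`.) -/
def IsTwoSidedExpander [DecidableEq V] (γ : ℝ) : Prop :=
  ∀ i : Fin (Fintype.card V), 0 < i.val → |G.normAdj_isHermitian.eigenvalues₀ i| ≤ γ

end WeightedGraph

/-! ### Local PSD ensembles -/

/-- A family of (mass functions of) distributions, one on the assignments `S → A` for every finite
set `S` of variables. -/
abbrev LocalFamily (V A : Type) : Type := (S : Finset V) → (S → A) → ℝ

namespace LocalFamily

variable {V A : Type} [Fintype V] [DecidableEq V] [Fintype A] [DecidableEq A]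

/-- The probability of `Z_S = α` and `Z_T = β`, computed in the distribution of `Z_{S ∪ T}`. -/
noncomputable def pairProb (P : LocalFamily V A) (S T : Finset V) (α : S → A) (β : T → A) : ℝ :=
  ∑ χ : ↥(S ∪ T) → A,
    if Finset.restrict₂ (π := fun _ => A) Finset.subset_union_left χ = α ∧
        Finset.restrict₂ (π := fun _ => A) Finset.subset_union_right χ = β
    then P (S ∪ T) χ else 0

/-- The family conditioned on `Z_T = ξ`; meaningful if this event has positive probability. -/
noncomputable def cond (P : LocalFamily V A) (T : Finset V) (ξ : T → A) : LocalFamily V A :=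
  fun S α => P.pairProb S T α ξ / P T ξ

/-- The matrix of covariances of the indicators `1[Z_S = α]` and `1[Z_{S'} = α']`, where `S` and
`S'` satisfy a given condition `small`. -/
noncomputable def covMatrix (P : LocalFamily V A) (small : Finset V → Prop) :
    Matrix ((S : {S : Finset V // small S}) × (S.1 → A))
      ((S : {S : Finset V // small S}) × (S.1 → A)) ℝ :=
  Matrix.of fun x y => P.pairProb x.1.1 y.1.1 x.2 y.2 - P x.1.1 x.2 * P y.1.1 y.2

/-- The probability of `Z_v = a`. -/
def single (P : LocalFamily V A) (v : V) (a : A) : ℝ := P {v} fun _ => a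

/-- The joint distribution of the tuple `(Z_{f i})_i`: the probability that `Z_{f i} = a i` for all
`i`. The tuple `f` may have repeated entries. -/
noncomputable def tuple (P : LocalFamily V A) {ι : Type} [Fintype ι] (f : ι → V) (a : ι → A) : ℝ :=
  ∑ χ : ↥(Finset.univ.image f) → A,
    if ∀ i, χ ⟨f i, Finset.mem_image_of_mem f (Finset.mem_univ i)⟩ = a i
    then P (Finset.univ.image f) χ else 0

end LocalFamily

/-- A `t`-local PSD ensemble `{Z_v}_{v ∈ V}` with values in `A`: consistent probability
distributions on the assignments to every set of at most `t` variables such that, for every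
conditioning on an event `Z_T = ξ` of positive probability with `|T| ≤ t - 2`, the
covariance matrix of the indicators `1[Z_S = α]`, `|S| ≤ (t - |T|) / 2`, is positive
semidefinite. (The values `prob S` with `|S| > t` are irrelevant.) -/
structure LocalPSDEnsemble (V A : Type) [Fintype V] [DecidableEq V] [Fintype A] [DecidableEq A]
    (t : ℕ) where
  prob : LocalFamily V A
  nonneg : ∀ S : Finset V, S.card ≤ t → ∀ α, 0 ≤ prob S α
  sum_eq_one : ∀ S : Finset V, S.card ≤ t → ∑ α, prob S α = 1
  consistent : ∀ (T S : Finset V) (h : T ⊆ S), S.card ≤ t → ∀ β : T → A,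
    (∑ α : S → A, if Finset.restrict₂ (π := fun _ => A) h α = β then prob S α else 0) = prob T β
  posSemidef : ∀ (T : Finset V) (ξ : T → A), T.card + 2 ≤ t → 0 < prob T ξ →
    ((prob.cond T ξ).covMatrix fun S => 2 * S.card + T.card ≤ t).PosSemidef

/-! ### Propagation rounding and tensoriality -/

namespace LocalPSDEnsemble

variable {V A : Type} [Fintype V] [DecidableEq V] [Fintype A] [DecidableEq A]

/-- `|supp(Z_v)| ≤ q` for every variable. -/
def SupportLE {t : ℕ} (Z : LocalPSDEnsemble V A t) (q : ℕ) : Prop :=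
  ∀ v, (Finset.univ.filter fun a => Z.prob.single v a ≠ 0).card ≤ q

/-- The set of seed vertices of a sequence of tuples. -/
def seed {k m : ℕ} (s : Fin m → Fin k → V) : Finset V :=
  Finset.univ.biUnion fun j => Finset.univ.image (s j)

/-- The expectation over the slices `(m, S, σ)` of propagation rounding of a functional `F` of the
conditioned ensemble `Z' = {Z | Z_S = σ}`: `m` is uniform in `{1, …, ⌊L / k⌋}`, `S` is the union of
`m` independent tuples drawn from `Pk`, and `σ` is drawn from the distribution of `Z_S`. -/
noncomputable def sliceExpectation {t k : ℕ} (Z : LocalPSDEnsemble V A t) (Pk : (Fin k → V) → ℝ)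
    (L : ℕ) (F : LocalFamily V A → ℝ) : ℝ :=
  (∑ m ∈ Finset.Icc 1 (L / k), ∑ s : Fin m → Fin k → V, (∏ j, Pk (s j)) *
    ∑ σ : seed s → A, Z.prob (seed s) σ * F (Z.prob.cond (seed s) σ)) / ((L / k : ℕ) : ℝ)

/-- The `(μ, L)`-tensorial condition for the tuples drawn from `Pk`, with respect to the
`(L + 2k)`-local PSD ensemble `Z` given to propagation rounding. The norm is the `ℓ¹` norm
on functions of `k` letters; `k ≤ L` says that `{1, …, ⌊L / k⌋}` is not empty. -/
def IsTensorial {L k : ℕ} (Z : LocalPSDEnsemble V A (L + 2 * k)) (Pk : (Fin k → V) → ℝ)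
    (μ : ℝ) : Prop :=
  k ≤ L ∧ Z.sliceExpectation Pk L (fun Z' => ∑ w : Fin k → V, Pk w *
    ∑ a : Fin k → A, |Z'.tuple w a - ∏ i, Z'.single (w i) (a i)|) ≤ μ

/-- The `(μ, L)`-two-step tensorial condition: `(μ, L)`-tensorial and, for two independent tuples
drawn from `Pk`, the joint distribution is close to the product of the two. -/
def IsTwoStepTensorial {L k : ℕ} (Z : LocalPSDEnsemble V A (L + 2 * k)) (Pk : (Fin k → V) → ℝ)
    (μ : ℝ) : Prop :=
  Z.IsTensorial Pk μ ∧
    Z.sliceExpectation Pk L (fun Z' => ∑ s : Fin k → V, ∑ t : Fin k → V, Pk s * Pk t *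
      ∑ a : Fin k → A, ∑ b : Fin k → A,
        |Z'.tuple (Sum.elim s t) (Sum.elim a b) - Z'.tuple s a * Z'.tuple t b|) ≤ μ

end LocalPSDEnsemble

/-!
The energy of a random tuple relative to a set of revealed variables is its expected conditional
collision probability. It lies in `[0, 1]`, and revealing one more independent tuple raises it by
the mean `χ²` correlation of two independent tuples. Over the `⌊L / k⌋` possible numbers of seed
tuples these increments telescope, so the `χ²` correlation of two independent walks is on average at
most `1 / ⌊L / k⌋`. Cauchy–Schwarz on the supports turns this into an `ℓ¹` bound.

For a single walk, its vertices are split off one at a time, from the last to the first. A Gram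
representation of the positive semidefinite covariance matrix writes the squared `ℓ²` covariance of
a prefix and a vertex as an inner product of a vector depending on the prefix with one depending on
the vertex. By expansion, its mean over a step of the walk exceeds its mean over an independent
stationary vertex by at most `γ`, and the latter is controlled by two independent walks.
-/

section FunctionSpaces

open Finset

theorem sum_sum_arrow {ι κ A M : Type*} [Fintype ι] [DecidableEq ι] [Fintype κ] [DecidableEq κ]
    [Fintype A] [AddCommMonoid M] (F : (ι ⊕ κ → A) → M) :
    ∑ c, F c = ∑ a, ∑ b, F (Sum.elim a b) := by
  rw [← (Equiv.sumArrowEquivProdArrow ι κ A).symm.sum_comp, Fintype.sum_prod_type]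
  rfl

theorem sum_fin_succ_arrow {A M : Type*} [Fintype A] [AddCommMonoid M] {k : ℕ}
    (F : (Fin (k + 1) → A) → M) :
    ∑ w, F w = ∑ s : Fin k → A, ∑ v, F (Fin.snoc s v : Fin (k + 1) → A) := by
  rw [← (Fin.snocEquiv fun _ => A).sum_comp, Fintype.sum_prod_type, sum_comm]
  rfl

end FunctionSpaces

namespace LocalFamily

open Finset

variable {V A : Type} [DecidableEq V] [Fintype A] [DecidableEq A]
  {P : LocalFamily V A} {n : ℕ} {ι κ : Type} [Fintype ι] [Fintype κ]

/-- The values on the sets of at most `n` variables are consistent probability distributions. These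
are the axioms of a local ensemble apart from positive semidefiniteness. -/
structure IsConsistent (P : LocalFamily V A) (n : ℕ) : Prop where
  nonneg : ∀ S : Finset V, #S ≤ n → ∀ α, 0 ≤ P S α
  sum_eq_one : ∀ S : Finset V, #S ≤ n → ∑ α, P S α = 1
  consistent : ∀ (T S : Finset V) (h : T ⊆ S), #S ≤ n → ∀ β : T → A,
    (∑ α : S → A, if restrict₂ (π := fun _ => A) h α = β then P S α else 0) = P T β

/-- A tuple as a surjection onto its finset of entries. -/
def imageFactorization (f : ι → V) (i : ι) : ↥(univ.image f) :=
  ⟨f i, mem_image_of_mem f (mem_univ i)⟩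

/-- The probability of `Z_f = a` and `Z_g = b`. -/
noncomputable def joint (P : LocalFamily V A) (f : ι → V) (g : κ → V) (a : ι → A) (b : κ → A) :
    ℝ :=
  P.tuple (Sum.elim f g) (Sum.elim a b)

theorem card_image_univ_le (f : ι → V) : #(univ.image f) ≤ Fintype.card ι :=
  card_image_le

theorem tuple_eq_sum_image (f : ι → V) (a : ι → A) :
    P.tuple f a =
      ∑ χ : ↥(univ.image f) → A with χ ∘ imageFactorization f = a, P (univ.image f) χ := by
  simp only [tuple, sum_filter, funext_iff]
  rfl

namespace IsConsistent

theorem tuple_val_comp (hP : P.IsConsistent n) {U : Finset V} (hU : #U ≤ n) (f : ι → U)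
    (a : ι → A) :
    P.tuple (Subtype.val ∘ f) a = ∑ χ : U → A with χ ∘ f = a, P U χ := by
  have hfU : univ.image (Subtype.val ∘ f) ⊆ U := image_subset_iff.2 fun i _ => (f i).2
  simp_rw [tuple_eq_sum_image, ← hP.consistent _ U hfU hU, ← sum_filter]
  rw [sum_fiberwise_eq_sum_filter]
  simp only [mem_filter, mem_univ, true_and]
  rfl

theorem tuple_val (hP : P.IsConsistent n) {T : Finset V} (hT : #T ≤ n) (α : T → A) :
    P.tuple (Subtype.val : T → V) α = P T α := by
  simpa [sum_filter] using hP.tuple_val_comp hT id α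

theorem tuple_nonneg (hP : P.IsConsistent n) (hι : Fintype.card ι ≤ n) (f : ι → V) (a : ι → A) :
    0 ≤ P.tuple f a := by
  rw [tuple_eq_sum_image]
  exact sum_nonneg fun χ _ => hP.nonneg _ ((card_image_univ_le f).trans hι) χ

theorem tuple_comp [DecidableEq ι] (hP : P.IsConsistent n) (hι : Fintype.card ι ≤ n) (f : ι → V)
    (e : κ → ι) (b : κ → A) :
    P.tuple (f ∘ e) b = ∑ a : ι → A with a ∘ e = b, P.tuple f a := by
  simp_rw [tuple_eq_sum_image (P := P) f]
  rw [sum_fiberwise_eq_sum_filter]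
  simp only [mem_filter, mem_univ, true_and]
  exact hP.tuple_val_comp ((card_image_univ_le f).trans hι) (imageFactorization f ∘ e) b

theorem sum_tuple [DecidableEq ι] (hP : P.IsConsistent n) (hι : Fintype.card ι ≤ n) (f : ι → V) :
    ∑ a, P.tuple f a = 1 := by
  simp_rw [tuple_eq_sum_image]
  rw [sum_fiberwise]
  exact hP.sum_eq_one _ ((card_image_univ_le f).trans hι)

theorem tuple_le_tuple_comp (hP : P.IsConsistent n) (hι : Fintype.card ι ≤ n) (f : ι → V)
    (e : κ → ι) (a : ι → A) : P.tuple f a ≤ P.tuple (f ∘ e) (a ∘ e) := by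
  classical
  rw [hP.tuple_comp hι]
  exact single_le_sum (fun a' _ => hP.tuple_nonneg hι f a') (by simp)

theorem tuple_comp_of_surjective (hP : P.IsConsistent n) (hι : Fintype.card ι ≤ n) (f : ι → V)
    {e : κ → ι} (he : Function.Surjective e) (a : ι → A) :
    P.tuple (f ∘ e) (a ∘ e) = P.tuple f a := by
  classical
  rw [hP.tuple_comp hι]
  simp [he.injective_comp_right.eq_iff, sum_filter]

theorem tuple_const [Nonempty ι] (hP : P.IsConsistent n) (hn : 1 ≤ n) (v : V) (a : A) :
    P.tuple (fun _ : ι => v) (fun _ => a) = P.single v a := by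
  have he : Function.Surjective fun _ : ι => (⟨v, mem_singleton_self v⟩ : ({v} : Finset V)) :=
    fun x => ⟨Classical.arbitrary ι, Subtype.ext (mem_singleton.1 x.2).symm⟩
  have hv : #({v} : Finset V) ≤ n := (card_singleton v).trans_le hn
  exact (hP.tuple_comp_of_surjective (by simpa using hn) Subtype.val he fun _ => a).trans
    (hP.tuple_val hv _)

theorem single_nonneg (hP : P.IsConsistent n) (hn : 1 ≤ n) (v : V) (a : A) : 0 ≤ P.single v a :=
  hP.nonneg _ ((card_singleton v).trans_le hn) _

theorem sum_single (hP : P.IsConsistent n) (hn : 1 ≤ n) (v : V) : ∑ a, P.single v a = 1 := by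
  rw [← hP.sum_tuple (by simpa using hn) fun _ : Unit => v,
    ← (Equiv.funUnique Unit A).symm.sum_comp]
  exact sum_congr rfl fun a _ => (hP.tuple_const hn v a).symm

theorem tuple_le_single (hP : P.IsConsistent n) (hι : Fintype.card ι ≤ n) (f : ι → V) (a : ι → A)
    (i : ι) : P.tuple f a ≤ P.single (f i) (a i) := by
  rw [← hP.tuple_const (ι := Unit) ((Fintype.card_pos_iff.2 ⟨i⟩).trans_le hι)]
  exact hP.tuple_le_tuple_comp hι f (fun _ : Unit => i) a

end IsConsistent

end LocalFamily

namespace LocalFamily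

open Finset

variable {V A : Type} [DecidableEq V] [Fintype A] [DecidableEq A]
  {P : LocalFamily V A} {n : ℕ} {ι κ ι' κ' : Type} [Fintype ι] [Fintype κ] [Fintype ι']
  [Fintype κ']

namespace IsConsistent

theorem joint_nonneg (hP : P.IsConsistent n) (h : Fintype.card ι + Fintype.card κ ≤ n) (f : ι → V)
    (g : κ → V) (a : ι → A) (b : κ → A) : 0 ≤ P.joint f g a b :=
  hP.tuple_nonneg (by simpa using h) _ _

theorem joint_le_left (hP : P.IsConsistent n) (h : Fintype.card ι + Fintype.card κ ≤ n) (f : ι → V)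
    (g : κ → V) (a : ι → A) (b : κ → A) : P.joint f g a b ≤ P.tuple f a :=
  hP.tuple_le_tuple_comp (by simpa using h) _ Sum.inl _

theorem joint_le_right (hP : P.IsConsistent n) (h : Fintype.card ι + Fintype.card κ ≤ n)
    (f : ι → V) (g : κ → V) (a : ι → A) (b : κ → A) : P.joint f g a b ≤ P.tuple g b :=
  hP.tuple_le_tuple_comp (by simpa using h) _ Sum.inr _

theorem joint_comp [DecidableEq ι] [DecidableEq κ] (hP : P.IsConsistent n)
    (h : Fintype.card ι + Fintype.card κ ≤ n) (f : ι → V) (g : κ → V) (e : ι' → ι) (e' : κ' → κ)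
    (a' : ι' → A) (b' : κ' → A) :
    P.joint (f ∘ e) (g ∘ e') a' b' =
      ∑ a with a ∘ e = a', ∑ b with b ∘ e' = b', P.joint f g a b := by
  rw [joint, ← Sum.elim_comp_map, hP.tuple_comp (by simpa using h), sum_filter, sum_sum_arrow]
  simp only [Sum.elim_comp_map, Sum.elim_eq_iff, ite_and, sum_filter]
  exact sum_congr rfl fun a _ => by split_ifs <;> simp [joint]

theorem joint_comp_left [DecidableEq ι] (hP : P.IsConsistent n)
    (h : Fintype.card ι + Fintype.card κ ≤ n) (f : ι → V) (g : κ → V) (e : ι' → ι)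
    (a' : ι' → A) (b : κ → A) :
    P.joint (f ∘ e) g a' b = ∑ a with a ∘ e = a', P.joint f g a b := by
  classical
  simpa [Finset.filter_eq'] using hP.joint_comp h f g e id a' b

theorem sum_joint_fst [DecidableEq ι] (hP : P.IsConsistent n)
    (h : Fintype.card ι + Fintype.card κ ≤ n) (f : ι → V) (g : κ → V) (b : κ → A) :
    ∑ a, P.joint f g a b = P.tuple g b := by
  classical
  have key := hP.tuple_comp (by simpa using h) (Sum.elim f g) Sum.inr b
  rw [sum_filter, sum_sum_arrow] at key
  exact (key.trans (sum_congr rfl fun a _ =>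
    (Fintype.sum_eq_single b fun _ hb => if_neg hb).trans (if_pos rfl))).symm

theorem sum_joint_snd [DecidableEq κ] (hP : P.IsConsistent n)
    (h : Fintype.card ι + Fintype.card κ ≤ n) (f : ι → V) (g : κ → V) (a : ι → A) :
    ∑ b, P.joint f g a b = P.tuple f a := by
  classical
  have key := hP.tuple_comp (by simpa using h) (Sum.elim f g) Sum.inl a
  rw [sum_filter, sum_sum_arrow, sum_comm] at key
  exact (key.trans (sum_congr rfl fun b _ =>
    (Fintype.sum_eq_single a fun _ ha => if_neg ha).trans (if_pos rfl))).symm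

theorem pairProb_eq_joint (hP : P.IsConsistent n) {S T : Finset V} (h : #S + #T ≤ n) (α : S → A)
    (β : T → A) : P.pairProb S T α β = P.joint Subtype.val Subtype.val α β := by
  let e : S ⊕ T → ↥(S ∪ T) :=
    Sum.elim (Set.inclusion subset_union_left) (Set.inclusion subset_union_right)
  have he : Sum.elim Subtype.val Subtype.val = Subtype.val ∘ e := by ext (i | i) <;> rfl
  rw [joint, he, hP.tuple_val_comp ((card_union_le S T).trans h), pairProb, sum_filter]
  simp only [e, Sum.comp_elim, Sum.elim_eq_iff]
  rfl

theorem cond_apply (hP : P.IsConsistent n) {S T : Finset V} (h : #S + #T ≤ n) (ξ : T → A)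
    (α : S → A) : P.cond T ξ S α = P.joint Subtype.val Subtype.val α ξ / P T ξ := by
  rw [cond, hP.pairProb_eq_joint h]

theorem cond_tuple (hP : P.IsConsistent n) {T : Finset V} (h : Fintype.card ι + #T ≤ n)
    (ξ : T → A) (f : ι → V) (a : ι → A) :
    (P.cond T ξ).tuple f a = P.joint f Subtype.val a ξ / P T ξ := by
  have hf : #(univ.image f) + #T ≤ n := (Nat.add_le_add_right (card_image_univ_le f) _).trans h
  simp_rw [tuple_eq_sum_image, hP.cond_apply hf, ← sum_div]
  rw [← hP.joint_comp_left (by simpa using hf)]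
  rfl

theorem cond_joint (hP : P.IsConsistent n) {T : Finset V}
    (h : Fintype.card ι + Fintype.card κ + #T ≤ n) (ξ : T → A) (f : ι → V) (g : κ → V) (a : ι → A)
    (b : κ → A) :
    (P.cond T ξ).joint f g a b =
      P.joint f (Sum.elim g (Subtype.val : T → V)) a (Sum.elim b ξ) / P T ξ := by
  rw [joint, hP.cond_tuple (by simpa using h), joint, joint,
    ← hP.tuple_comp_of_surjective (by simpa [add_assoc] using h) _
      (Equiv.sumAssoc ι κ T).surjective]
  congr 2 <;> ext ((i | i) | i) <;> rfl

theorem cond_isConsistent (hP : P.IsConsistent n) {T : Finset V} {r : ℕ} (h : r + #T ≤ n)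
    {ξ : T → A} (hξ : 0 < P T ξ) : (P.cond T ξ).IsConsistent r where
  nonneg S hS α := by
    have hST : #S + #T ≤ n := by omega
    rw [hP.cond_apply hST]
    exact div_nonneg (hP.joint_nonneg (by simpa using hST) _ _ _ _) hξ.le
  sum_eq_one S hS := by
    have hST : #S + #T ≤ n := by omega
    simp_rw [hP.cond_apply hST]
    rw [← sum_div, hP.sum_joint_fst (by simpa using hST), hP.tuple_val (by omega),
      div_self hξ.ne']
  consistent U S hUS hS β := by
    have hST : #S + #T ≤ n := by omega
    have hUT : #U + #T ≤ n := (Nat.add_le_add_right (card_le_card hUS) _).trans hST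
    rw [hP.cond_apply hUT]
    simp_rw [hP.cond_apply hST]
    rw [← sum_filter, ← sum_div]
    exact congrArg (· / P T ξ)
      (hP.joint_comp_left (by simpa using hST) Subtype.val Subtype.val (Set.inclusion hUS) β ξ).symm

end IsConsistent

end LocalFamily

section FiniteSums

open Finset

theorem sum_sum_sq_sum_mul {α β N : Type*} [Fintype α] [Fintype β] [Fintype N] (x : α → N → ℝ)
    (y : β → N → ℝ) :
    ∑ a, ∑ b, (∑ i, x a i * y b i) ^ 2 =
      ∑ p : N × N, (∑ a, x a p.1 * x a p.2) * ∑ b, y b p.1 * y b p.2 := by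
  rw [← Fintype.sum_prod_type' fun a b => (∑ i, x a i * y b i) ^ 2]
  simp_rw [sq, Fintype.sum_mul_sum, ← Fintype.sum_prod_type']
  exact Fintype.sum_equiv (Equiv.prodComm _ _) _ _ fun _ => mul_mul_mul_comm _ _ _ _

theorem sum_sum_abs_sum_fiber_le {α β α' β' : Type*} [Fintype α] [Fintype β] [Fintype α']
    [Fintype β'] [DecidableEq α'] [DecidableEq β'] (F : α → β → ℝ) (u : α → α') (v : β → β') :
    ∑ a', ∑ b', |∑ a with u a = a', ∑ b with v b = b', F a b| ≤ ∑ a, ∑ b, |F a b| :=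
  calc ∑ a', ∑ b', |∑ a with u a = a', ∑ b with v b = b', F a b|
      ≤ ∑ a', ∑ b', ∑ a with u a = a', ∑ b with v b = b', |F a b| := by
        gcongr
        exact (abs_sum_le_sum_abs _ _).trans (sum_le_sum fun a _ => abs_sum_le_sum_abs _ _)
    _ = ∑ a', ∑ a with u a = a', ∑ b, |F a b| := by
        refine sum_congr rfl fun a' _ => ?_
        rw [sum_comm]
        exact sum_congr rfl fun a _ => sum_fiberwise univ v fun b => |F a b|
    _ = ∑ a, ∑ b, |F a b| := sum_fiberwise univ u fun a => ∑ b, |F a b|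

end FiniteSums

namespace LocalFamily

open Finset

variable {V A : Type} [Fintype A] {P : LocalFamily V A} {q : ℕ} {ι : Type} [Fintype ι]
  [DecidableEq ι]

/-- At most `q` letters have positive probability at every vertex. -/
def HasSupportLE (P : LocalFamily V A) (q : ℕ) : Prop :=
  ∀ v, #{a | P.single v a ≠ 0} ≤ q

/-- The assignments to the tuple `f` all of whose letters have positive probability. -/
noncomputable def support (P : LocalFamily V A) (f : ι → V) : Finset (ι → A) :=
  Fintype.piFinset fun i => {a | P.single (f i) a ≠ 0}

theorem HasSupportLE.card_support_le (hq : P.HasSupportLE q) (f : ι → V) :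
    #(P.support f) ≤ q ^ Fintype.card ι := by
  rw [support, Fintype.card_piFinset]
  exact prod_le_pow_card _ _ _ fun i _ => hq (f i)

end LocalFamily

namespace LocalFamily

open Finset

variable {V A : Type} [DecidableEq V] [Fintype A] [DecidableEq A] {P : LocalFamily V A} {n q : ℕ}
  {ι κ ι' κ' : Type} [Fintype ι] [Fintype κ] [Fintype ι'] [Fintype κ']

/-- The covariance of the indicators of `Z_f = a` and `Z_g = b`. -/
noncomputable def cov (P : LocalFamily V A) (f : ι → V) (g : κ → V) (a : ι → A) (b : κ → A) : ℝ :=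
  P.joint f g a b - P.tuple f a * P.tuple g b

/-- The `ℓ¹` distance between the joint distribution of `Z_f` and `Z_g` and the product of their
distributions. -/
noncomputable def l1Cov [DecidableEq ι] [DecidableEq κ] (P : LocalFamily V A) (f : ι → V)
    (g : κ → V) : ℝ :=
  ∑ a, ∑ b, |P.cov f g a b|

/-- The square of the `ℓ²` distance between the joint distribution of `Z_f` and `Z_g` and the
product of their distributions. -/
noncomputable def l2Cov [DecidableEq ι] [DecidableEq κ] (P : LocalFamily V A) (f : ι → V)
    (g : κ → V) : ℝ :=
  ∑ a, ∑ b, P.cov f g a b ^ 2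

/-- The sum over `a` of the expected drop of the variance of the indicator of `Z_f = a` when `Z_g`
is revealed. -/
noncomputable def chiSq [DecidableEq ι] [DecidableEq κ] (P : LocalFamily V A) (f : ι → V)
    (g : κ → V) : ℝ :=
  ∑ a, ∑ b, P.cov f g a b ^ 2 / P.tuple g b

theorem l1Cov_nonneg [DecidableEq ι] [DecidableEq κ] (f : ι → V) (g : κ → V) : 0 ≤ P.l1Cov f g :=
  sum_nonneg fun _ _ => sum_nonneg fun _ _ => abs_nonneg _

theorem l2Cov_le_l1Cov_sq [DecidableEq ι] [DecidableEq κ] (f : ι → V) (g : κ → V) :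
    P.l2Cov f g ≤ P.l1Cov f g ^ 2 := by
  simp only [l2Cov, l1Cov, ← Fintype.sum_prod_type', ← sq_abs (P.cov _ _ _ _)]
  exact sum_sq_le_sq_sum_of_nonneg fun _ _ => abs_nonneg _

namespace IsConsistent

theorem cov_comp [DecidableEq ι] [DecidableEq κ] (hP : P.IsConsistent n)
    (h : Fintype.card ι + Fintype.card κ ≤ n) (f : ι → V) (g : κ → V) (e : ι' → ι) (e' : κ' → κ)
    (a' : ι' → A) (b' : κ' → A) :
    P.cov (f ∘ e) (g ∘ e') a' b' = ∑ a with a ∘ e = a', ∑ b with b ∘ e' = b', P.cov f g a b := by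
  simp only [cov, sum_sub_distrib]
  rw [hP.joint_comp h, hP.tuple_comp (by omega), hP.tuple_comp (by omega), sum_mul_sum]

theorem l1Cov_comp_le [DecidableEq ι] [DecidableEq κ] [DecidableEq ι'] [DecidableEq κ']
    (hP : P.IsConsistent n) (h : Fintype.card ι + Fintype.card κ ≤ n) (f : ι → V) (g : κ → V)
    (e : ι' → ι) (e' : κ' → κ) : P.l1Cov (f ∘ e) (g ∘ e') ≤ P.l1Cov f g := by
  simp only [l1Cov, hP.cov_comp h]
  exact sum_sum_abs_sum_fiber_le (P.cov f g) (· ∘ e) (· ∘ e')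

theorem tuple_le_one (hP : P.IsConsistent n) (h : Fintype.card ι ≤ n) (f : ι → V)
    (a : ι → A) : P.tuple f a ≤ 1 := by
  classical
  exact (single_le_sum (fun a _ => hP.tuple_nonneg h f a) (mem_univ a)).trans_eq (hP.sum_tuple h f)

theorem l2Cov_le_one [DecidableEq ι] [DecidableEq κ] (hP : P.IsConsistent n)
    (h : Fintype.card ι + Fintype.card κ ≤ n) (f : ι → V) (g : κ → V) : P.l2Cov f g ≤ 1 := by
  have hf := hP.sum_tuple (by omega) f
  have hg := hP.sum_tuple (by omega) g
  calc P.l2Cov f g ≤ ∑ a, ∑ b, P.tuple f a * P.tuple g b := by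
        refine sum_le_sum fun a _ => sum_le_sum fun b _ => ?_
        have hfa := hP.tuple_nonneg (by omega) f a
        have hgb := hP.tuple_nonneg (by omega) g b
        have hJ := hP.joint_nonneg h f g a b
        have hJle := mul_le_mul (hP.joint_le_left h f g a b) (hP.joint_le_right h f g a b) hJ hfa
        have hprod := mul_le_one₀ (hP.tuple_le_one (by omega) f a) hgb
          (hP.tuple_le_one (by omega) g b)
        rw [cov]
        nlinarith [mul_nonneg hJ (mul_nonneg hfa hgb),
          mul_le_mul_of_nonneg_left hprod (mul_nonneg hfa hgb)]
    _ = 1 := by rw [← sum_mul_sum, hf, hg, one_mul]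

theorem cov_eq_zero_left (hP : P.IsConsistent n) (h : Fintype.card ι + Fintype.card κ ≤ n)
    (f : ι → V) (g : κ → V) {a : ι → A} (b : κ → A) (ha : P.tuple f a = 0) :
    P.cov f g a b = 0 := by
  have hJ := le_antisymm (ha ▸ hP.joint_le_left h f g a b) (hP.joint_nonneg h f g a b)
  rw [cov, hJ, ha, zero_mul, sub_zero]

theorem cov_eq_zero_right (hP : P.IsConsistent n) (h : Fintype.card ι + Fintype.card κ ≤ n)
    (f : ι → V) (g : κ → V) (a : ι → A) {b : κ → A} (hb : P.tuple g b = 0) :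
    P.cov f g a b = 0 := by
  have hJ := le_antisymm (hb ▸ hP.joint_le_right h f g a b) (hP.joint_nonneg h f g a b)
  rw [cov, hJ, hb, mul_zero, sub_zero]

theorem tuple_eq_zero_of_notMem_support [DecidableEq ι] (hP : P.IsConsistent n)
    (h : Fintype.card ι ≤ n) {f : ι → V} {a : ι → A} (ha : a ∉ P.support f) : P.tuple f a = 0 := by
  simp only [support, Fintype.mem_piFinset, mem_filter, mem_univ, true_and, not_forall,
    not_not] at ha
  obtain ⟨i, hi⟩ := ha
  exact le_antisymm (hi ▸ hP.tuple_le_single h f a i) (hP.tuple_nonneg h f a)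

theorem l1Cov_eq_sum_support [DecidableEq ι] [DecidableEq κ] (hP : P.IsConsistent n)
    (h : Fintype.card ι + Fintype.card κ ≤ n) (f : ι → V) (g : κ → V) :
    P.l1Cov f g = ∑ x ∈ P.support f ×ˢ P.support g, |P.cov f g x.1 x.2| := by
  rw [l1Cov, ← Fintype.sum_prod_type']
  refine (sum_subset (subset_univ _) fun x _ hx => abs_eq_zero.2 ?_).symm
  rw [mem_product, not_and_or] at hx
  rcases hx with hx | hx
  · exact hP.cov_eq_zero_left h f g _ (hP.tuple_eq_zero_of_notMem_support (by omega) hx)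
  · exact hP.cov_eq_zero_right h f g _ (hP.tuple_eq_zero_of_notMem_support (by omega) hx)

theorem l1Cov_sq_le_l2Cov [DecidableEq ι] [DecidableEq κ] (hP : P.IsConsistent n)
    (hq : P.HasSupportLE q) (h : Fintype.card ι + Fintype.card κ ≤ n) (f : ι → V) (g : κ → V) :
    P.l1Cov f g ^ 2 ≤ q ^ (Fintype.card ι + Fintype.card κ) * P.l2Cov f g := by
  rw [hP.l1Cov_eq_sum_support h, l2Cov, ← Fintype.sum_prod_type' fun a b => P.cov f g a b ^ 2]
  refine sq_sum_le_card_mul_sum_sq.trans ?_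
  simp only [sq_abs]
  gcongr
  · rw [card_product, pow_add]
    exact_mod_cast Nat.mul_le_mul (hq.card_support_le f) (hq.card_support_le g)
  · exact subset_univ _

theorem l1Cov_sq_le_chiSq [DecidableEq ι] [DecidableEq κ] (hP : P.IsConsistent n)
    (hq : P.HasSupportLE q) (h : Fintype.card ι + Fintype.card κ ≤ n) (f : ι → V) (g : κ → V) :
    P.l1Cov f g ^ 2 ≤ q ^ Fintype.card ι * P.chiSq f g := by
  have hκ : Fintype.card κ ≤ n := by omega
  have hg := hP.tuple_nonneg hκ g
  have hdiv : ∀ a b, 0 ≤ P.cov f g a b ^ 2 / P.tuple g b :=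
    fun a b => div_nonneg (sq_nonneg _) (hg b)
  have hmass : ∑ x ∈ P.support f ×ˢ P.support g, P.tuple g x.2 ≤ (q : ℝ) ^ Fintype.card ι :=
    calc ∑ x ∈ P.support f ×ˢ P.support g, P.tuple g x.2
        ≤ ∑ x ∈ P.support f ×ˢ univ, P.tuple g x.2 :=
          sum_le_sum_of_subset_of_nonneg (product_subset_product_right (subset_univ _))
            fun x _ _ => hg x.2
      _ = #(P.support f) := by simp [sum_product, hP.sum_tuple hκ]
      _ ≤ (q : ℝ) ^ Fintype.card ι := mod_cast hq.card_support_le f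
  have hchi : ∑ x ∈ P.support f ×ˢ P.support g, P.cov f g x.1 x.2 ^ 2 / P.tuple g x.2 ≤
      P.chiSq f g := by
    rw [chiSq, ← Fintype.sum_prod_type' fun a b => P.cov f g a b ^ 2 / P.tuple g b]
    exact sum_le_sum_of_subset_of_nonneg (subset_univ _) fun x _ _ => hdiv x.1 x.2
  rw [hP.l1Cov_eq_sum_support h]
  refine (sum_sq_le_sum_mul_sum_of_sq_le_mul _ (fun x _ => hg x.2) (fun x _ => hdiv x.1 x.2)
    fun x _ => ?_).trans
    (mul_le_mul hmass hchi (sum_nonneg fun x _ => hdiv x.1 x.2) (by positivity))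
  rw [sq_abs, mul_div_cancel_of_imp']
  exact fun hx => by rw [hP.cov_eq_zero_right h f g x.1 hx, zero_pow two_ne_zero]

end IsConsistent

theorem covMatrix_posSemidef_mono {small small' : Finset V → Prop}
    (h : ∀ S, small' S → small S) (hP : (P.covMatrix small).PosSemidef) :
    (P.covMatrix small').PosSemidef :=
  let e : ((S : {S : Finset V // small' S}) × (S.1 → A)) →
      (S : {S : Finset V // small S}) × (S.1 → A) := fun x => ⟨⟨x.1.1, h _ x.1.2⟩, x.2⟩
  hP.submatrix e

open scoped MatrixOrder in
theorem IsConsistent.exists_cov_val_eq_sum_mul [Finite V] {k : ℕ} (hP : P.IsConsistent (2 * k))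
    (hpsd : (P.covMatrix fun S => #S ≤ k).PosSemidef) :
    ∃ (N : Type) (_ : Fintype N) (u : (S : Finset V) → (S → A) → N → ℝ),
      ∀ {S T : Finset V}, #S ≤ k → #T ≤ k → ∀ (α : S → A) (β : T → A),
        P.cov Subtype.val Subtype.val α β = ∑ x, u S α x * u T β x := by
  classical
  cases nonempty_fintype V
  obtain ⟨B, hB⟩ := CStarAlgebra.nonneg_iff_eq_star_mul_self.mp hpsd.nonneg
  refine ⟨_, inferInstance, fun S α x => if h : #S ≤ k then B x ⟨⟨S, h⟩, α⟩ else 0, ?_⟩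
  intro S T hS hT α β
  have h := congrFun₂ hB ⟨⟨S, hS⟩, α⟩ ⟨⟨T, hT⟩, β⟩
  simp only [covMatrix, Matrix.of_apply, Matrix.mul_apply, Matrix.star_apply, star_trivial] at h
  rw [cov, hP.tuple_val (by omega), hP.tuple_val (by omega), ← hP.pairProb_eq_joint (by omega), h]
  simp only [dif_pos hS, dif_pos hT]

theorem IsConsistent.exists_cov_eq_sum_mul [Finite V] {k : ℕ} (hP : P.IsConsistent (2 * k))
    (hpsd : (P.covMatrix fun S => #S ≤ k).PosSemidef) :
    ∃ (N : Type) (_ : Fintype N)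
      (u : ∀ {ι : Type} [Fintype ι] [DecidableEq ι], (ι → V) → (ι → A) → N → ℝ),
      ∀ {ι κ : Type} [Fintype ι] [DecidableEq ι] [Fintype κ] [DecidableEq κ],
        Fintype.card ι ≤ k → Fintype.card κ ≤ k → ∀ (f : ι → V) (g : κ → V) (a : ι → A)
        (b : κ → A), P.cov f g a b = ∑ x, u f a x * u g b x := by
  obtain ⟨N, _, u, hu⟩ := hP.exists_cov_val_eq_sum_mul hpsd
  refine ⟨N, inferInstance,
    fun f a x => ∑ χ with χ ∘ imageFactorization f = a, u (univ.image f) χ x, ?_⟩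
  intro ι κ _ _ _ _ hι hκ f g a b
  have hf := (card_image_univ_le f).trans hι
  have hg := (card_image_univ_le g).trans hκ
  have hfg : Fintype.card (univ.image f) + Fintype.card (univ.image g) ≤ 2 * k := by
    simp only [Fintype.card_coe]; omega
  have hcov := hP.cov_comp hfg Subtype.val Subtype.val (imageFactorization f)
    (imageFactorization g) a b
  simp_rw [hu hf hg] at hcov
  simp_rw [sum_mul_sum]
  rw [sum_comm]
  refine Eq.trans (show P.cov f g a b = _ from hcov) (sum_congr rfl fun χ _ => ?_)
  exact sum_comm

theorem IsConsistent.exists_l2Cov_eq_sum_mul [Finite V] {k : ℕ} (hP : P.IsConsistent (2 * k))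
    (hpsd : (P.covMatrix fun S => #S ≤ k).PosSemidef) :
    ∃ (N : Type) (_ : Fintype N)
      (M : ∀ {ι : Type} [Fintype ι] [DecidableEq ι], (ι → V) → N → ℝ),
      ∀ {ι κ : Type} [Fintype ι] [DecidableEq ι] [Fintype κ] [DecidableEq κ],
        Fintype.card ι ≤ k → Fintype.card κ ≤ k → ∀ (f : ι → V) (g : κ → V),
        P.l2Cov f g = ∑ x, M f x * M g x := by
  obtain ⟨N, _, u, hu⟩ := hP.exists_cov_eq_sum_mul hpsd
  refine ⟨N × N, inferInstance, fun f x => ∑ a, u f a x.1 * u f a x.2, ?_⟩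
  intro ι κ _ _ _ _ hι hκ f g
  simp only [l2Cov, hu hι hκ]
  exact sum_sum_sq_sum_mul (u f) (u g)

end LocalFamily

namespace LocalFamily

open Finset

variable {V A : Type} [DecidableEq V] [Fintype A] [DecidableEq A] {P : LocalFamily V A} {n : ℕ}
  {ι κ κ' : Type} [Fintype ι] [DecidableEq ι] [Fintype κ] [DecidableEq κ] [Fintype κ']
  [DecidableEq κ']

/-- The sum over `a` of the second moment of the conditional probability of `Z_f = a` given `Z_g`.
It increases from the collision probability of `Z_f` to at most `1` as variables are added
to `g`. -/
noncomputable def energy (P : LocalFamily V A) (f : ι → V) (g : κ → V) : ℝ :=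
  ∑ a, ∑ b, P.joint f g a b ^ 2 / P.tuple g b

namespace IsConsistent

theorem energy_nonneg (hP : P.IsConsistent n) (h : Fintype.card κ ≤ n) (f : ι → V) (g : κ → V) :
    0 ≤ P.energy f g :=
  sum_nonneg fun _ _ => sum_nonneg fun b _ => div_nonneg (sq_nonneg _) (hP.tuple_nonneg h g b)

theorem energy_le_one (hP : P.IsConsistent n) (h : Fintype.card ι + Fintype.card κ ≤ n)
    (f : ι → V) (g : κ → V) : P.energy f g ≤ 1 :=
  calc P.energy f g ≤ ∑ a, ∑ b, P.joint f g a b := by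
        refine sum_le_sum fun a _ => sum_le_sum fun b _ => ?_
        have hJ := hP.joint_nonneg h f g a b
        rw [sq, mul_div_assoc]
        exact mul_le_of_le_one_right hJ (div_le_one_of_le₀ (hP.joint_le_right h f g a b)
          (hP.tuple_nonneg (by omega) g b))
    _ = 1 := by simp_rw [hP.sum_joint_snd h, hP.sum_tuple (show Fintype.card ι ≤ n by omega)]

theorem energy_comp_of_surjective (hP : P.IsConsistent n) (h : Fintype.card ι + Fintype.card κ ≤ n)
    (f : ι → V) (g : κ → V) {e : κ' → κ} (he : Function.Surjective e) :
    P.energy f (g ∘ e) = P.energy f g := by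
  have hκ : Fintype.card κ ≤ n := by omega
  refine sum_congr rfl fun a _ => (Fintype.sum_of_injective (· ∘ e) he.injective_comp_right _ _
    (fun b hb => ?_) fun b => ?_).symm
  · have hzero : P.tuple (g ∘ e) b = 0 := by
      rw [hP.tuple_comp hκ, filter_false_of_mem fun b' _ hb' => hb ⟨b', hb'⟩, sum_empty]
    rw [hzero, div_zero]
  · have hjoint : P.joint f (g ∘ e) a (b ∘ e) = P.joint f g a b := by
      have hmap : Function.Surjective (Sum.map id e : ι ⊕ κ' → ι ⊕ κ) :=
        Sum.map_surjective.2 ⟨Function.surjective_id, he⟩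
      rw [joint, joint, ← hP.tuple_comp_of_surjective (by simpa using h) _ hmap,
        Sum.elim_comp_map, Sum.elim_comp_map, Function.comp_id, Function.comp_id]
    rw [hjoint, hP.tuple_comp_of_surjective hκ g he]

theorem chiSq_eq_energy_sub (hP : P.IsConsistent n) (h : Fintype.card ι + Fintype.card κ ≤ n)
    (f : ι → V) (g : κ → V) : P.chiSq f g = P.energy f g - ∑ a, P.tuple f a ^ 2 := by
  rw [chiSq, energy, ← sum_sub_distrib]
  refine sum_congr rfl fun a _ => ?_
  have hexpand (b : κ → A) : P.cov f g a b ^ 2 / P.tuple g b =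
      P.joint f g a b ^ 2 / P.tuple g b - 2 * P.tuple f a * P.joint f g a b +
        P.tuple f a ^ 2 * P.tuple g b := by
    rw [cov]
    rcases eq_or_ne (P.tuple g b) 0 with hb | hb
    · have hJ := le_antisymm (hb ▸ hP.joint_le_right h f g a b) (hP.joint_nonneg h f g a b)
      simp [hb, hJ]
    · field_simp
      ring
  simp_rw [hexpand]
  rw [sum_add_distrib, sum_sub_distrib, ← mul_sum, ← mul_sum, hP.sum_joint_snd h,
    hP.sum_tuple (by omega)]
  ring

theorem sum_mul_cond_energy (hP : P.IsConsistent n) {T : Finset V}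
    (h : Fintype.card ι + Fintype.card κ + #T ≤ n) (f : ι → V) (g : κ → V) :
    ∑ σ, P T σ * (P.cond T σ).energy f g = P.energy f (Sum.elim g (Subtype.val : T → V)) := by
  have hκT : Fintype.card κ + #T ≤ n := by omega
  simp only [energy, sum_sum_arrow, mul_sum]
  rw [sum_comm]
  refine sum_congr rfl fun a _ => ?_
  rw [sum_comm]
  refine sum_congr rfl fun b _ => sum_congr rfl fun σ _ => ?_
  rw [hP.cond_joint h, hP.cond_tuple hκT, joint]
  rcases eq_or_ne (P T σ) 0 with hσ | hσ
  · have hle : P.joint g Subtype.val b σ ≤ P T σ :=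
      (hP.joint_le_right (by simpa using hκT) _ _ b σ).trans_eq (hP.tuple_val (by omega) σ)
    have hzero : P.tuple (Sum.elim g Subtype.val) (Sum.elim b σ) = 0 :=
      le_antisymm (hle.trans_eq hσ) (hP.joint_nonneg (by simpa using hκT) _ _ b σ)
    rw [hσ, hzero, zero_mul, div_zero]
  · rw [div_pow, div_div_div_eq, joint]
    field_simp

theorem sum_mul_cond_sum_tuple_sq (hP : P.IsConsistent n) {T : Finset V}
    (h : Fintype.card ι + #T ≤ n) (f : ι → V) :
    ∑ σ, P T σ * ∑ a, (P.cond T σ).tuple f a ^ 2 = P.energy f (Subtype.val : T → V) := by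
  simp only [energy, mul_sum]
  rw [sum_comm]
  refine sum_congr rfl fun a _ => sum_congr rfl fun σ _ => ?_
  rw [hP.cond_tuple h, hP.tuple_val (by omega)]
  rcases eq_or_ne (P T σ) 0 with hσ | hσ
  · simp [hσ]
  · field_simp

theorem sum_mul_cond_chiSq (hP : P.IsConsistent n) {T : Finset V}
    (h : Fintype.card ι + Fintype.card κ + #T ≤ n) (f : ι → V) (g : κ → V) :
    ∑ σ, P T σ * (P.cond T σ).chiSq f g =
      P.energy f (Subtype.val : ↥(T ∪ univ.image g) → V) - P.energy f (Subtype.val : T → V) := by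
  let e : κ ⊕ T → ↥(T ∪ univ.image g) :=
    Sum.elim (Set.inclusion subset_union_right ∘ imageFactorization g)
      (Set.inclusion subset_union_left)
  have he : Function.Surjective e := by
    rintro ⟨v, hv⟩
    rcases mem_union.1 hv with hv | hv
    · exact ⟨Sum.inr ⟨v, hv⟩, rfl⟩
    · obtain ⟨i, -, rfl⟩ := mem_image.1 hv
      exact ⟨Sum.inl i, rfl⟩
  have hge : Sum.elim g (Subtype.val : T → V) = Subtype.val ∘ e := by ext (i | i) <;> rfl
  have hcard : Fintype.card ι + Fintype.card ↥(T ∪ univ.image g) ≤ n := by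
    have := card_union_le T (univ.image g)
    have := card_image_univ_le g
    rw [Fintype.card_coe]
    omega
  rw [← hP.energy_comp_of_surjective hcard f Subtype.val he, ← hge, ← hP.sum_mul_cond_energy h,
    ← hP.sum_mul_cond_sum_tuple_sq (by omega), ← sum_sub_distrib]
  refine sum_congr rfl fun σ _ => ?_
  rcases (hP.nonneg T (by omega) σ).eq_or_lt with hσ | hσ
  · simp [← hσ]
  · rw [(hP.cond_isConsistent h hσ).chiSq_eq_energy_sub le_rfl, mul_sub]

end IsConsistent

end LocalFamily

theorem sum_prod_eq_one {X : Type*} [Fintype X] {D : X → ℝ} (hD : ∑ x, D x = 1) (m : ℕ) :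
    ∑ s : Fin m → X, ∏ j, D (s j) = 1 := by
  rw [← Fintype.prod_sum fun _ : Fin m => D, hD, Finset.prod_const_one]

theorem mul_le_of_mem_Icc_div {k L m a : ℕ} (hm : m ∈ Finset.Icc a (L / k)) : m * k ≤ L :=
  (Nat.mul_le_mul_right k (Finset.mem_Icc.1 hm).2).trans (Nat.div_mul_le_self L k)

namespace LocalFamily

open Finset

variable {V A : Type} [Fintype V] [DecidableEq V] [Fintype A] [DecidableEq A] {P : LocalFamily V A}
  {n : ℕ} {ι : Type} [Fintype ι] [DecidableEq ι] {D : (ι → V) → ℝ}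

/-- The expectation of `P.chiSq s t` for independent tuples `s` and `t` drawn from `D`. -/
noncomputable def meanChiSq (P : LocalFamily V A) (D : (ι → V) → ℝ) : ℝ :=
  ∑ s, ∑ t, D s * D t * P.chiSq s t

/-- The expectation of the energy of a tuple drawn from `D` relative to the variables in `T`: the
potential function of propagation rounding. -/
noncomputable def meanEnergy (P : LocalFamily V A) (D : (ι → V) → ℝ) (T : Finset V) : ℝ :=
  ∑ s, D s * P.energy s (Subtype.val : T → V)

namespace IsConsistent

theorem meanEnergy_nonneg (hP : P.IsConsistent n) (hD : ∀ s, 0 ≤ D s) {T : Finset V}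
    (hT : #T ≤ n) : 0 ≤ P.meanEnergy D T :=
  sum_nonneg fun s _ => mul_nonneg (hD s) (hP.energy_nonneg (by simpa using hT) s _)

theorem meanEnergy_le_one (hP : P.IsConsistent n) (hD : ∀ s, 0 ≤ D s) (hD1 : ∑ s, D s = 1)
    {T : Finset V} (hT : Fintype.card ι + #T ≤ n) : P.meanEnergy D T ≤ 1 := by
  rw [← hD1]
  exact sum_le_sum fun s _ =>
    mul_le_of_le_one_right (hD s) (hP.energy_le_one (by simpa using hT) s _)

theorem sum_mul_cond_meanChiSq (hP : P.IsConsistent n) (hD1 : ∑ s, D s = 1) {T : Finset V}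
    (hT : Fintype.card ι + Fintype.card ι + #T ≤ n) :
    ∑ σ, P T σ * (P.cond T σ).meanChiSq D =
      ∑ t, D t * P.meanEnergy D (T ∪ univ.image t) - P.meanEnergy D T :=
  calc ∑ σ, P T σ * (P.cond T σ).meanChiSq D
      = ∑ t, ∑ s, D t * D s * ∑ σ, P T σ * (P.cond T σ).chiSq s t := by
        simp only [meanChiSq, mul_sum]
        rw [sum_comm_cycle]
        refine sum_congr rfl fun t _ => sum_comm.trans (sum_congr rfl fun s _ => ?_)
        exact sum_congr rfl fun σ _ => by ring
    _ = ∑ t, (D t * P.meanEnergy D (T ∪ univ.image t) - D t * P.meanEnergy D T) := by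
        simp only [hP.sum_mul_cond_chiSq hT, meanEnergy, mul_sub, sum_sub_distrib, mul_sum,
          mul_assoc]
    _ = ∑ t, D t * P.meanEnergy D (T ∪ univ.image t) - P.meanEnergy D T := by
        rw [sum_sub_distrib, ← sum_mul, hD1, one_mul]

end IsConsistent

end LocalFamily

namespace LocalPSDEnsemble

open Finset

variable {V A : Type} [DecidableEq V]

theorem card_seed_le {k m : ℕ} (s : Fin m → Fin k → V) : #(seed s) ≤ m * k := by
  refine (card_biUnion_le_card_mul _ _ k fun j _ => ?_).trans (by simp)
  simpa using card_image_le (s := univ) (f := s j)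

theorem seed_cons {k m : ℕ} (t : Fin k → V) (s : Fin m → Fin k → V) :
    seed (Fin.cons t s : Fin (m + 1) → Fin k → V) = seed s ∪ univ.image t := by
  ext v
  simp [seed, Fin.exists_fin_succ, or_comm]

variable [Fintype V] [Fintype A] [DecidableEq A] {t k L m : ℕ} {D : (Fin k → V) → ℝ}
  {F F' : LocalFamily V A → ℝ} {a b : ℝ}

theorem isConsistent (Z : LocalPSDEnsemble V A t) : Z.prob.IsConsistent t :=
  ⟨Z.nonneg, Z.sum_eq_one, Z.consistent⟩

/-- The expectation of `F` over the ensemble conditioned on the values of `m` independent tuples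
drawn from `D`, that is, the `m`-th of the slices averaged in `sliceExpectation`. -/
noncomputable def seedExpectation (Z : LocalPSDEnsemble V A t) (D : (Fin k → V) → ℝ) (m : ℕ)
    (F : LocalFamily V A → ℝ) : ℝ :=
  ∑ s : Fin m → Fin k → V, (∏ j, D (s j)) *
    ∑ σ : seed s → A, Z.prob (seed s) σ * F (Z.prob.cond (seed s) σ)

theorem seedExpectation_mono (Z : LocalPSDEnsemble V A t) (hD : ∀ w, 0 ≤ D w) (hm : m * k ≤ t)
    (hF : ∀ (T : Finset V) (σ : T → A), #T ≤ m * k → 0 < Z.prob T σ →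
      F (Z.prob.cond T σ) ≤ F' (Z.prob.cond T σ)) :
    Z.seedExpectation D m F ≤ Z.seedExpectation D m F' := by
  refine sum_le_sum fun s _ => mul_le_mul_of_nonneg_left (sum_le_sum fun σ _ => ?_)
    (prod_nonneg fun j _ => hD _)
  rcases (Z.nonneg (seed s) ((card_seed_le s).trans hm) σ).eq_or_lt with hσ | hσ
  · simp [← hσ]
  · exact mul_le_mul_of_nonneg_left (hF _ _ (card_seed_le s) hσ) hσ.le

theorem seedExpectation_add_mul (Z : LocalPSDEnsemble V A t) (hD1 : ∑ w, D w = 1)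
    (hm : m * k ≤ t) (a b : ℝ) (F : LocalFamily V A → ℝ) :
    Z.seedExpectation D m (fun P => a + b * F P) = a + b * Z.seedExpectation D m F := by
  have hslice (s : Fin m → Fin k → V) :
      ∑ σ : seed s → A, Z.prob (seed s) σ * (a + b * F (Z.prob.cond (seed s) σ)) =
        a + b * ∑ σ : seed s → A, Z.prob (seed s) σ * F (Z.prob.cond (seed s) σ) := by
    simp only [mul_add, sum_add_distrib, ← sum_mul, mul_left_comm _ b, ← mul_sum,
      Z.sum_eq_one _ ((card_seed_le s).trans hm), one_mul]
  simp only [seedExpectation, hslice]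
  simp only [mul_add, sum_add_distrib, ← sum_mul, mul_left_comm _ b, ← mul_sum,
    sum_prod_eq_one hD1, one_mul]

theorem sliceExpectation_le_add_mul (Z : LocalPSDEnsemble V A t) (hk : 1 ≤ k) (hkL : k ≤ L)
    (hLt : L ≤ t) (hD : ∀ w, 0 ≤ D w) (hD1 : ∑ w, D w = 1)
    (hF : ∀ (T : Finset V) (σ : T → A), #T ≤ L → 0 < Z.prob T σ →
      F (Z.prob.cond T σ) ≤ a + b * F' (Z.prob.cond T σ)) :
    Z.sliceExpectation D L F ≤ a + b * Z.sliceExpectation D L F' := by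
  have hL : (0 : ℝ) < (L / k : ℕ) := Nat.cast_pos.2 (Nat.div_pos hkL hk)
  calc Z.sliceExpectation D L F
      ≤ (∑ m ∈ Icc 1 (L / k), (a + b * Z.seedExpectation D m F')) / (L / k : ℕ) := by
        refine div_le_div_of_nonneg_right (sum_le_sum fun m hm => ?_) hL.le
        have hmL := mul_le_of_mem_Icc_div hm
        rw [← Z.seedExpectation_add_mul hD1 (hmL.trans hLt)]
        exact Z.seedExpectation_mono hD (hmL.trans hLt) fun T σ hT => hF T σ (hT.trans hmL)
    _ = a + b * Z.sliceExpectation D L F' := by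
        rw [sum_add_distrib, ← mul_sum, sum_const, Nat.card_Icc, Nat.add_sub_cancel,
          nsmul_eq_mul, add_div, mul_div_cancel_left₀ _ hL.ne', mul_div_assoc]
        rfl

/-- The expectation of `P.meanEnergy D` over the sets of vertices of `m` independent tuples. -/
noncomputable def seedEnergy (P : LocalFamily V A) (D : (Fin k → V) → ℝ) (m : ℕ) : ℝ :=
  ∑ s : Fin m → Fin k → V, (∏ j, D (s j)) * P.meanEnergy D (seed s)

theorem seedEnergy_succ (P : LocalFamily V A) (D : (Fin k → V) → ℝ) (m : ℕ) :
    seedEnergy P D (m + 1) = ∑ s : Fin m → Fin k → V, (∏ j, D (s j)) *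
      ∑ t, D t * P.meanEnergy D (seed s ∪ univ.image t) := by
  rw [seedEnergy, ← (Fin.consEquiv fun _ => Fin k → V).sum_comp, Fintype.sum_prod_type, sum_comm]
  refine sum_congr rfl fun s _ => ?_
  rw [mul_sum]
  refine sum_congr rfl fun t _ => ?_
  simp only [Fin.consEquiv, Equiv.coe_fn_mk, Fin.prod_univ_succ, Fin.cons_zero, Fin.cons_succ,
    seed_cons]
  ring

theorem seedExpectation_meanChiSq (Z : LocalPSDEnsemble V A t) (hD1 : ∑ w, D w = 1)
    (hm : m * k + 2 * k ≤ t) :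
    Z.seedExpectation D m (fun P => P.meanChiSq D) =
      seedEnergy Z.prob D (m + 1) - seedEnergy Z.prob D m := by
  rw [seedEnergy_succ, seedEnergy, ← sum_sub_distrib]
  refine sum_congr rfl fun s _ => ?_
  have hs := card_seed_le s
  rw [Z.isConsistent.sum_mul_cond_meanChiSq hD1 (by rw [Fintype.card_fin]; omega), mul_sub]

theorem seedEnergy_nonneg (Z : LocalPSDEnsemble V A t) (hD : ∀ w, 0 ≤ D w) (hm : m * k ≤ t) :
    0 ≤ seedEnergy Z.prob D m :=
  sum_nonneg fun s _ => mul_nonneg (prod_nonneg fun _ _ => hD _)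
    (Z.isConsistent.meanEnergy_nonneg hD ((card_seed_le s).trans hm))

theorem seedEnergy_le_one (Z : LocalPSDEnsemble V A t) (hD : ∀ w, 0 ≤ D w) (hD1 : ∑ w, D w = 1)
    (hm : k + m * k ≤ t) : seedEnergy Z.prob D m ≤ 1 := by
  rw [← sum_prod_eq_one hD1 m]
  refine sum_le_sum fun s _ => mul_le_of_le_one_right (prod_nonneg fun _ _ => hD _)
    (Z.isConsistent.meanEnergy_le_one hD hD1 ?_)
  rw [Fintype.card_fin]
  exact (Nat.add_le_add_left (card_seed_le s) k).trans hm

/-- The energy gained by the successive slices telescopes to at most `1`. -/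
theorem sliceExpectation_meanChiSq_le (Z : LocalPSDEnsemble V A t) (hLt : L + 2 * k ≤ t)
    (hD : ∀ w, 0 ≤ D w) (hD1 : ∑ w, D w = 1) :
    Z.sliceExpectation D L (fun P => P.meanChiSq D) ≤ 1 / (L / k : ℕ) := by
  refine div_le_div_of_nonneg_right ?_ (Nat.cast_nonneg _)
  have hdiv := Nat.div_mul_le_self L k
  calc ∑ m ∈ Icc 1 (L / k), Z.seedExpectation D m (fun P => P.meanChiSq D)
      = ∑ m ∈ Icc 1 (L / k), (seedEnergy Z.prob D (m + 1) - seedEnergy Z.prob D m) := by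
        refine sum_congr rfl fun m hm => Z.seedExpectation_meanChiSq hD1 ?_
        have := mul_le_of_mem_Icc_div hm
        omega
    _ = seedEnergy Z.prob D (L / k + 1) - seedEnergy Z.prob D 1 := by
        rw [← Ico_add_one_right_eq_Icc, sum_Ico_sub _ (Nat.le_add_left 1 _)]
    _ ≤ 1 := by
        have hlast := Z.seedEnergy_le_one hD hD1 (m := L / k + 1) (by rw [add_mul]; omega)
        have hfirst := Z.seedEnergy_nonneg hD (m := 1) (by omega)
        linarith

end LocalPSDEnsemble

namespace WeightedGraph

open Finset

variable {V : Type} [Fintype V] (G : WeightedGraph V)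

theorem deg_pos (v : V) : 0 < G.deg v := by
  obtain ⟨u, hu⟩ := G.exists_weight_pos v
  exact sum_pos' (fun u _ => G.weight_nonneg v u) ⟨u, mem_univ u, hu⟩

theorem sum_deg_pos [Nonempty V] : 0 < ∑ u, G.deg u :=
  sum_pos (fun u _ => G.deg_pos u) univ_nonempty

theorem step_nonneg (u v : V) : 0 ≤ G.step u v :=
  div_nonneg (G.weight_nonneg u v) (G.deg_pos u).le

theorem sum_step (u : V) : ∑ v, G.step u v = 1 := by
  simp only [step, ← sum_div]
  exact div_self (G.deg_pos u).ne'

theorem stationary_nonneg (v : V) : 0 ≤ G.stationary v :=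
  div_nonneg (G.deg_pos v).le (sum_nonneg fun u _ => (G.deg_pos u).le)

theorem sum_stationary [Nonempty V] : ∑ v, G.stationary v = 1 := by
  simp only [stationary, ← sum_div]
  exact div_self G.sum_deg_pos.ne'

theorem stationary_mul_step (u v : V) :
    G.stationary u * G.step u v = G.weight u v / ∑ x, G.deg x := by
  have hu := (G.deg_pos u).ne'
  rw [stationary, step, div_mul_div_comm, mul_comm (G.deg u), mul_div_mul_right _ _ hu]

theorem sum_stationary_mul_step (v : V) : ∑ u, G.stationary u * G.step u v = G.stationary v := by
  simp only [stationary_mul_step, G.weight_symm _ v, ← sum_div]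
  rfl

theorem walkDist_nonneg {k : ℕ} (w : Fin k → V) : 0 ≤ G.walkDist k w := by
  cases k with
  | zero => exact zero_le_one
  | succ k => exact mul_nonneg (G.stationary_nonneg _) (prod_nonneg fun _ _ => G.step_nonneg _ _)

theorem walkDist_one (w : Fin 1 → V) : G.walkDist 1 w = G.stationary (w 0) := by
  simp [walkDist]

theorem walkDist_snoc {k : ℕ} (s : Fin (k + 1) → V) (v : V) :
    G.walkDist (k + 2) (Fin.snoc s v : Fin (k + 2) → V) =
      G.walkDist (k + 1) s * G.step (s (Fin.last k)) v := by
  simp only [walkDist]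
  rw [Fin.prod_univ_castSucc, ← mul_assoc, ← Fin.castSucc_zero]
  simp only [← Fin.castSucc_succ, Fin.succ_last, Fin.snoc_castSucc, Fin.snoc_last]

theorem sum_walkDist_init {k : ℕ} (F : (Fin (k + 1) → V) → ℝ) :
    ∑ w, G.walkDist (k + 2) w * F (Fin.init w) = ∑ s, G.walkDist (k + 1) s * F s := by
  rw [sum_fin_succ_arrow]
  simp only [Fin.init_snoc, ← sum_mul, walkDist_snoc, ← mul_sum, sum_step, mul_one]

theorem sum_walkDist_castLE {j k : ℕ} (h : j + 1 ≤ k + 1) (F : (Fin (j + 1) → V) → ℝ) :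
    ∑ w, G.walkDist (k + 1) w * F (w ∘ Fin.castLE h) = ∑ s, G.walkDist (j + 1) s * F s := by
  have hjk : j ≤ k := by omega
  induction k, hjk using Nat.le_induction with
  | base => rfl
  | succ k hjk ih =>
    have hk : j + 1 ≤ k + 1 := by omega
    exact (G.sum_walkDist_init fun s => F (s ∘ Fin.castLE hk)).trans (ih hk)

theorem sum_walkDist_one (F : (Fin 1 → V) → ℝ) :
    ∑ w, G.walkDist 1 w * F w = ∑ v, G.stationary v * F fun _ => v := by
  rw [← (Equiv.funUnique (Fin 1) V).symm.sum_comp]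
  exact sum_congr rfl fun v _ => by rw [walkDist_one]; rfl

theorem sum_walkDist [Nonempty V] (k : ℕ) : ∑ w, G.walkDist k w = 1 := by
  cases k with
  | zero => simp [walkDist]
  | succ k =>
    have h := G.sum_walkDist_castLE (Nat.le_add_left 1 k) fun _ => 1
    rw [sum_walkDist_one] at h
    simpa only [mul_one, sum_stationary] using h

theorem sum_walkDist_last (k : ℕ) (F : V → ℝ) :
    ∑ w, G.walkDist (k + 1) w * F (w (Fin.last k)) = ∑ v, G.stationary v * F v := by
  induction k generalizing F with
  | zero => exact G.sum_walkDist_one fun w => F (w (Fin.last 0))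
  | succ k ih =>
    rw [sum_fin_succ_arrow]
    simp only [walkDist_snoc, Fin.snoc_last, mul_assoc, ← mul_sum]
    rw [ih fun u => ∑ v, G.step u v * F v]
    simp only [mul_sum]
    rw [sum_comm]
    simp only [← mul_assoc, ← sum_mul, sum_stationary_mul_step]

end WeightedGraph

section SpectralGap

variable {E ι : Type*} [NormedAddCommGroup E] [InnerProductSpace ℝ E] [Fintype ι]
  {b : OrthonormalBasis ι ℝ E} {T : E →ₗ[ℝ] E} {eig : ι → ℝ} {γ : ℝ}

theorem inner_eigenbasis_map (hT : ∀ i, T (b i) = eig i • b i) (i : ι) (x : E) :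
    inner ℝ (b i) (T x) = eig i * inner ℝ (b i) x := by
  classical
  conv_lhs => rw [← b.sum_repr' x]
  simp [hT, inner_sum, inner_smul_right, b.inner_eq_ite, mul_comm]

theorem norm_map_sq_le_of_eigenvalues (hT : ∀ i, T (b i) = eig i • b i) {x : E}
    (hx : ∀ i, |eig i| ≤ γ ∨ inner ℝ (b i) x = 0) : ‖T x‖ ^ 2 ≤ γ ^ 2 * ‖x‖ ^ 2 := by
  rw [← b.sum_sq_inner_right, ← b.sum_sq_inner_right x, Finset.mul_sum]
  refine Finset.sum_le_sum fun i _ => ?_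
  rw [inner_eigenbasis_map hT, mul_pow]
  rcases hx i with h | h
  · gcongr ?_ * _
    exact sq_le_sq' (abs_le.1 h).1 (abs_le.1 h).2
  · simp [h]

theorem norm_map_sub_inner_smul_sq_le (hT : ∀ i, T (b i) = eig i • b i) (hγ : γ < 1) {j : ι}
    (heig : ∀ i ≠ j, |eig i| ≤ γ) {u : E} (hu : T u = u) (hu1 : ‖u‖ = 1) (x : E) :
    ‖T x - inner ℝ u x • u‖ ^ 2 ≤ γ ^ 2 * ‖x‖ ^ 2 := by
  have orthogonal : ∀ i ≠ j, inner ℝ (b i) u = 0 := fun i hi => by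
    have h := inner_eigenbasis_map hT i u
    rw [hu, eq_comm, mul_left_eq_self₀] at h
    exact h.resolve_left ((le_abs_self _).trans_lt ((heig i hi).trans_lt hγ)).ne
  have hbu : inner ℝ (b j) u • b j = u := by
    conv_rhs => rw [← b.sum_repr' u]
    rw [Fintype.sum_eq_single j fun i hi => by rw [orthogonal i hi, zero_smul]]
  have hy : inner ℝ u (x - inner ℝ u x • u) = 0 := by
    rw [inner_sub_right, inner_smul_right, real_inner_self_eq_norm_sq, hu1]
    ring
  have hby : inner ℝ (b j) (x - inner ℝ u x • u) = 0 := by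
    rw [← hbu, real_inner_smul_left, hbu] at hy
    refine (mul_eq_zero.1 hy).resolve_left fun h => ?_
    rw [h, zero_smul] at hbu
    simp [← hbu] at hu1
  calc ‖T x - inner ℝ u x • u‖ ^ 2
      = ‖T (x - inner ℝ u x • u)‖ ^ 2 := by rw [map_sub, map_smul, hu]
    _ ≤ γ ^ 2 * ‖x - inner ℝ u x • u‖ ^ 2 := norm_map_sq_le_of_eigenvalues hT fun i => by
        rcases eq_or_ne i j with rfl | hi
        exacts [.inr hby, .inl (heig i hi)]
    _ ≤ γ ^ 2 * ‖x‖ ^ 2 := by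
        gcongr ?_ * ?_
        rw [norm_sub_sq_real, norm_smul, hu1, real_inner_smul_right, real_inner_comm,
          Real.norm_eq_abs, mul_one, sq_abs]
        nlinarith [sq_nonneg (inner ℝ u x)]

end SpectralGap

namespace WeightedGraph

open Finset

variable {V : Type} [Fintype V] (G : WeightedGraph V)

/-- The random walk operator `D^{-1} W` on functions on the vertices. -/
noncomputable def walkOperator (g : V → ℝ) (u : V) : ℝ := ∑ v, G.step u v * g v

/-- The expectation of a function of a stationary vertex. -/
noncomputable def stationaryMean (g : V → ℝ) : ℝ := ∑ v, G.stationary v * g v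

/-- The isometric identification of `L²(stationary)` with Euclidean space; it conjugates the
walk operator to `normAdj`. -/
noncomputable def toEuclidean : (V → ℝ) →ₗ[ℝ] EuclideanSpace ℝ V where
  toFun g := WithLp.toLp 2 fun v => √(G.stationary v) * g v
  map_add' f g := by ext v; simp [mul_add]
  map_smul' a g := by ext v; simp [mul_left_comm]

theorem inner_toEuclidean (f g : V → ℝ) :
    inner ℝ (G.toEuclidean f) (G.toEuclidean g) = G.stationaryMean fun v => f v * g v := by
  simp only [PiLp.inner_apply, toEuclidean, LinearMap.coe_mk, AddHom.coe_mk, stationaryMean]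
  refine sum_congr rfl fun v _ => ?_
  rw [real_inner_comm, RCLike.inner_apply, conj_trivial, mul_mul_mul_comm,
    Real.mul_self_sqrt (G.stationary_nonneg v)]

theorem norm_toEuclidean_sq (g : V → ℝ) :
    ‖G.toEuclidean g‖ ^ 2 = G.stationaryMean fun v => g v ^ 2 := by
  rw [← real_inner_self_eq_norm_sq, inner_toEuclidean]
  simp only [sq]

theorem walkOperator_one : G.walkOperator 1 = 1 := by
  ext u
  simp [walkOperator, sum_step]

theorem normAdj_mul_sqrt_stationary (u v : V) :
    G.normAdj u v * √(G.stationary v) = √(G.stationary u) * G.step u v := by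
  have hu : √(G.deg u) ^ 2 = G.deg u := Real.sq_sqrt (G.deg_pos u).le
  have hu0 := Real.sqrt_ne_zero'.2 (G.deg_pos u)
  have hv0 := Real.sqrt_ne_zero'.2 (G.deg_pos v)
  rw [normAdj, Matrix.of_apply, stationary, stationary, step, Real.sqrt_div (G.deg_pos v).le,
    Real.sqrt_div (G.deg_pos u).le]
  nth_rw 3 [← hu]
  field_simp

variable [DecidableEq V]

theorem toEuclideanLin_normAdj (g : V → ℝ) :
    Matrix.toEuclideanLin G.normAdj (G.toEuclidean g) = G.toEuclidean (G.walkOperator g) := by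
  ext u
  change ∑ v, G.normAdj u v * (√(G.stationary v) * g v) = √(G.stationary u) * G.walkOperator g u
  simp only [walkOperator, mul_sum, ← mul_assoc, normAdj_mul_sqrt_stationary]

namespace IsTwoSidedExpander

variable {G} [Nonempty V] {γ : ℝ}

theorem stationaryMean_walkOperator_sub_sq_le (hG : G.IsTwoSidedExpander γ) (hγ : γ < 1)
    (g : V → ℝ) :
    G.stationaryMean (fun u => (G.walkOperator g u - G.stationaryMean g) ^ 2) ≤
      γ ^ 2 * G.stationaryMean fun v => g v ^ 2 := by
  have hsymm := Matrix.isSymmetric_toEuclideanLin_iff.mpr G.normAdj_isHermitian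
  have hfix : Matrix.toEuclideanLin G.normAdj (G.toEuclidean 1) = G.toEuclidean 1 := by
    rw [toEuclideanLin_normAdj, walkOperator_one]
  have hnorm : ‖G.toEuclidean 1‖ = 1 := by
    rw [← sq_eq_sq₀ (norm_nonneg _) zero_le_one, norm_toEuclidean_sq]
    simp [stationaryMean, sum_stationary]
  have hgap := norm_map_sub_inner_smul_sq_le (T := Matrix.toEuclideanLin G.normAdj)
    (eig := G.normAdj_isHermitian.eigenvalues₀) (j := ⟨0, Fintype.card_pos⟩)
    (hsymm.apply_eigenvectorBasis finrank_euclideanSpace) hγ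
    (fun i hi => hG i (Nat.pos_of_ne_zero fun h => hi (Fin.ext h))) hfix hnorm (G.toEuclidean g)
  have hinner : inner ℝ (G.toEuclidean 1) (G.toEuclidean g) = G.stationaryMean g := by
    simp [inner_toEuclidean]
  rw [hinner, toEuclideanLin_normAdj, ← map_smul, ← map_sub, norm_toEuclidean_sq,
    norm_toEuclidean_sq] at hgap
  simpa using hgap

theorem sum_walkDist_mul_le (hG : G.IsTwoSidedExpander γ) (hγ0 : 0 < γ) (hγ : γ < 1) {k : ℕ}
    (f : (Fin (k + 1) → V) → ℝ) (g : V → ℝ) :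
    ∑ w, G.walkDist (k + 2) w * (f (Fin.init w) * g (w (Fin.last (k + 1)))) ≤
      (∑ s, G.walkDist (k + 1) s * f s) * G.stationaryMean g +
        γ / 2 * (∑ s, G.walkDist (k + 1) s * f s ^ 2 + G.stationaryMean fun v => g v ^ 2) := by
  set e := G.stationaryMean g
  let deviation : V → ℝ := fun u => G.walkOperator g u - e
  have hdev : ∑ s, G.walkDist (k + 1) s * deviation (s (Fin.last k)) ^ 2 ≤
      γ ^ 2 * G.stationaryMean fun v => g v ^ 2 :=
    (G.sum_walkDist_last k fun u => deviation u ^ 2).trans_le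
      (hG.stationaryMean_walkOperator_sub_sq_le hγ g)
  have young : ∀ s : Fin (k + 1) → V, f s * deviation (s (Fin.last k)) ≤
      γ / 2 * f s ^ 2 + γ⁻¹ / 2 * deviation (s (Fin.last k)) ^ 2 := fun s => by
    linarith [two_mul_le_add_mul_sq (a := f s) (b := deviation (s (Fin.last k))) hγ0]
  calc ∑ w, G.walkDist (k + 2) w * (f (Fin.init w) * g (w (Fin.last (k + 1))))
      = ∑ s, G.walkDist (k + 1) s * (f s * e + f s * deviation (s (Fin.last k))) := by
        rw [sum_fin_succ_arrow]
        refine sum_congr rfl fun s _ => ?_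
        simp only [walkDist_snoc, Fin.init_snoc, Fin.snoc_last, deviation, walkOperator, ← mul_add,
          add_sub_cancel, mul_sum]
        exact sum_congr rfl fun v _ => by ring
    _ ≤ ∑ s, G.walkDist (k + 1) s *
          (f s * e + (γ / 2 * f s ^ 2 + γ⁻¹ / 2 * deviation (s (Fin.last k)) ^ 2)) :=
        sum_le_sum fun s _ => mul_le_mul_of_nonneg_left (by gcongr; exact young s)
          (G.walkDist_nonneg s)
    _ = (∑ s, G.walkDist (k + 1) s * f s) * e + (γ / 2 * ∑ s, G.walkDist (k + 1) s * f s ^ 2 +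
          γ⁻¹ / 2 * ∑ s, G.walkDist (k + 1) s * deviation (s (Fin.last k)) ^ 2) := by
        simp only [sum_mul, mul_sum, ← sum_add_distrib]
        exact sum_congr rfl fun s _ => by ring
    _ ≤ (∑ s, G.walkDist (k + 1) s * f s) * e + (γ / 2 * ∑ s, G.walkDist (k + 1) s * f s ^ 2 +
          γ⁻¹ / 2 * (γ ^ 2 * G.stationaryMean fun v => g v ^ 2)) := by gcongr
    _ = _ := by field_simp

theorem sum_walkDist_sum_mul_le (hG : G.IsTwoSidedExpander γ) (hγ0 : 0 < γ) (hγ : γ < 1) {k : ℕ}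
    {N : Type*} [Fintype N] {f : (Fin (k + 1) → V) → N → ℝ} {g : V → N → ℝ}
    (hf : ∀ s, ∑ x, f s x ^ 2 ≤ 1) (hg : ∀ v, ∑ x, g v x ^ 2 ≤ 1) :
    ∑ w, G.walkDist (k + 2) w * ∑ x, f (Fin.init w) x * g (w (Fin.last (k + 1))) x ≤
      ∑ s, ∑ v, G.walkDist (k + 1) s * G.stationary v * ∑ x, f s x * g v x + γ := by
  have hf1 : ∑ x, ∑ s, G.walkDist (k + 1) s * f s x ^ 2 ≤ 1 := by
    rw [sum_comm, ← G.sum_walkDist (k + 1)]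
    simp only [← mul_sum]
    exact sum_le_sum fun s _ => mul_le_of_le_one_right (G.walkDist_nonneg s) (hf s)
  have hg1 : ∑ x, G.stationaryMean (fun v => g v x ^ 2) ≤ 1 := by
    simp only [stationaryMean]
    rw [sum_comm, ← G.sum_stationary]
    simp only [← mul_sum]
    exact sum_le_sum fun v _ => mul_le_of_le_one_right (G.stationary_nonneg v) (hg v)
  calc ∑ w, G.walkDist (k + 2) w * ∑ x, f (Fin.init w) x * g (w (Fin.last (k + 1))) x
      = ∑ x, ∑ w, G.walkDist (k + 2) w * (f (Fin.init w) x * g (w (Fin.last (k + 1))) x) := by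
        simp only [mul_sum]
        exact sum_comm
    _ ≤ ∑ x, ((∑ s, G.walkDist (k + 1) s * f s x) * G.stationaryMean (fun v => g v x) + γ / 2 *
          (∑ s, G.walkDist (k + 1) s * f s x ^ 2 + G.stationaryMean fun v => g v x ^ 2)) :=
        sum_le_sum fun x _ => hG.sum_walkDist_mul_le hγ0 hγ (fun s => f s x) fun v => g v x
    _ = ∑ x, (∑ s, G.walkDist (k + 1) s * f s x) * G.stationaryMean (fun v => g v x) + γ / 2 *
          (∑ x, ∑ s, G.walkDist (k + 1) s * f s x ^ 2 +
            ∑ x, G.stationaryMean fun v => g v x ^ 2) := by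
        rw [sum_add_distrib, ← mul_sum, sum_add_distrib]
    _ ≤ ∑ x, (∑ s, G.walkDist (k + 1) s * f s x) * G.stationaryMean (fun v => g v x) +
          γ / 2 * (1 + 1) := by gcongr
    _ = _ := by
        simp only [stationaryMean, sum_mul_sum]
        simp only [mul_sum]
        rw [← sum_comm_cycle]
        congr 1
        · exact sum_congr rfl fun s _ => sum_congr rfl fun v _ => sum_congr rfl fun x _ => by ring
        · ring

end IsTwoSidedExpander

end WeightedGraph

theorem sum_mul_le_add_mul_sum_mul_sq {X : Type*} [Fintype X] {D : X → ℝ} (hD : ∀ x, 0 ≤ D x)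
    (hD1 : ∑ x, D x = 1) {c : ℝ} (hc : 0 < c) (f : X → ℝ) :
    ∑ x, D x * f x ≤ c / 2 + 1 / (2 * c) * ∑ x, D x * f x ^ 2 := by
  have hpoint (x : X) : f x ≤ c / 2 + 1 / (2 * c) * f x ^ 2 := by
    have hsq : c / 2 + 1 / (2 * c) * f x ^ 2 - f x = (f x - c) ^ 2 / (2 * c) := by
      field_simp
      ring
    exact sub_nonneg.1 (hsq ▸ by positivity)
  calc ∑ x, D x * f x ≤ ∑ x, D x * (c / 2 + 1 / (2 * c) * f x ^ 2) :=
        Finset.sum_le_sum fun x _ => mul_le_mul_of_nonneg_left (hpoint x) (hD x)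
    _ = c / 2 + 1 / (2 * c) * ∑ x, D x * f x ^ 2 := by
        simp only [mul_add, Finset.sum_add_distrib, ← Finset.sum_mul, hD1, one_mul,
          mul_left_comm (D _), ← Finset.mul_sum]

namespace WeightedGraph

open Finset

theorem sum_walkDist_mul_sum_stationary {V : Type} [Fintype V] (G : WeightedGraph V) {j k : ℕ}
    (h : j + 1 ≤ k + 1) (F : (Fin (j + 1) → V) → V → ℝ) :
    ∑ s, ∑ t, G.walkDist (k + 1) s * G.walkDist (k + 1) t *
        F (s ∘ Fin.castLE h) (t (Fin.last k)) =
      ∑ s, ∑ v, G.walkDist (j + 1) s * G.stationary v * F s v := by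
  simp only [mul_assoc, ← mul_sum, fun s => G.sum_walkDist_last k (F s)]
  exact G.sum_walkDist_castLE h fun s => ∑ v, G.stationary v * F s v

end WeightedGraph

namespace LocalFamily

open Finset

variable {V A : Type} [DecidableEq V] [Fintype A] [DecidableEq A] {P : LocalFamily V A} {n q : ℕ}

/-- The `ℓ¹` distance between the joint distribution of `Z_f` and the product of the distributions
of its entries. -/
noncomputable def prodDist {ι : Type} [Fintype ι] [DecidableEq ι] (P : LocalFamily V A)
    (f : ι → V) : ℝ :=
  ∑ a, |P.tuple f a - ∏ i, P.single (f i) (a i)|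

namespace IsConsistent

theorem prodDist_eq_zero_of_unique {ι : Type} [Unique ι] [Fintype ι] [DecidableEq ι]
    (hP : P.IsConsistent n) (hn : 1 ≤ n) (f : ι → V) : P.prodDist f = 0 := by
  refine sum_eq_zero fun a _ => abs_eq_zero.2 (sub_eq_zero.2 ?_)
  rw [Fintype.prod_unique, ← hP.tuple_const (ι := ι) hn]
  congr 1 <;> exact eq_const_of_unique _

theorem tuple_snoc (hP : P.IsConsistent n) {j : ℕ} (hj : j + 1 ≤ n) (w : Fin (j + 1) → V)
    (a : Fin j → A) (x : A) :
    P.tuple w (Fin.snoc a x : Fin (j + 1) → A) =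
      P.joint (Fin.init w) (fun _ : Unit => w (Fin.last j)) a fun _ => x := by
  have he : Function.Surjective (Sum.elim Fin.castSucc fun _ : Unit => Fin.last j) :=
    Fin.lastCases ⟨Sum.inr (), rfl⟩ fun i => ⟨Sum.inl i, rfl⟩
  rw [joint, ← hP.tuple_comp_of_surjective (by simpa using hj) w he]
  congr 1 <;> ext (i | i) <;> simp [Fin.init]

theorem l1Cov_init_last (hP : P.IsConsistent n) {j : ℕ} (hj : j + 1 ≤ n) (w : Fin (j + 1) → V) :
    P.l1Cov (Fin.init w) (fun _ : Unit => w (Fin.last j)) =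
      ∑ a : Fin j → A, ∑ x, |P.tuple w (Fin.snoc a x : Fin (j + 1) → A) -
        P.tuple (Fin.init w) a * P.single (w (Fin.last j)) x| := by
  refine sum_congr rfl fun a _ => ?_
  rw [← (Equiv.funUnique Unit A).symm.sum_comp]
  refine sum_congr rfl fun x _ => ?_
  rw [hP.tuple_snoc hj, ← hP.tuple_const (ι := Unit) (by omega)]
  rfl

theorem prodDist_le (hP : P.IsConsistent n) {j : ℕ} (hj : j + 1 ≤ n) (w : Fin (j + 1) → V) :
    P.prodDist w ≤
      P.l1Cov (Fin.init w) (fun _ : Unit => w (Fin.last j)) + P.prodDist (Fin.init w) := by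
  have hn : 1 ≤ n := by omega
  have hinit : P.prodDist (Fin.init w) = ∑ a : Fin j → A, ∑ x,
      |P.tuple (Fin.init w) a - ∏ i, P.single (Fin.init w i) (a i)| *
        P.single (w (Fin.last j)) x := by
    simp only [prodDist, ← mul_sum, hP.sum_single hn, mul_one]
  rw [hP.l1Cov_init_last hj, hinit, prodDist, sum_fin_succ_arrow]
  simp only [← sum_add_distrib]
  gcongr with a _ x _
  rw [Fin.prod_univ_castSucc, ← abs_of_nonneg (hP.single_nonneg hn (w (Fin.last j)) x),
    ← abs_mul, abs_of_nonneg (hP.single_nonneg hn (w (Fin.last j)) x), sub_mul]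
  simp only [Fin.snoc_castSucc, Fin.snoc_last]
  exact abs_sub_le _ _ _

theorem one_le_of_hasSupportLE [Nonempty V] (hP : P.IsConsistent n) (hn : 1 ≤ n)
    (hq : P.HasSupportLE q) : 1 ≤ q := by
  obtain ⟨v⟩ := ‹Nonempty V›
  have hv : ∑ a, P.single v a ≠ 0 := (hP.sum_single hn v).trans_ne one_ne_zero
  obtain ⟨a, -, ha⟩ := exists_ne_zero_of_sum_ne_zero hv
  exact (card_pos.2 ⟨a, by simpa using ha⟩).trans_le (hq v)

section IndependentTuples

variable [Fintype V] {ι : Type} [Fintype ι] [DecidableEq ι] {D : (ι → V) → ℝ}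

theorem sum_sum_l1Cov_sq_le (hP : P.IsConsistent n) (hq : P.HasSupportLE q)
    (h : Fintype.card ι + Fintype.card ι ≤ n) (hD : ∀ w, 0 ≤ D w) :
    ∑ s, ∑ t, D s * D t * P.l1Cov s t ^ 2 ≤ q ^ Fintype.card ι * P.meanChiSq D := by
  simp only [meanChiSq, mul_sum, mul_left_comm ((q : ℝ) ^ _)]
  gcongr with s _ t _
  · exact mul_nonneg (hD s) (hD t)
  · exact hP.l1Cov_sq_le_chiSq hq h s t

theorem sum_sum_l1Cov_le (hP : P.IsConsistent n) (hq : P.HasSupportLE q)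
    (h : Fintype.card ι + Fintype.card ι ≤ n) (hD : ∀ w, 0 ≤ D w) (hD1 : ∑ w, D w = 1) {c : ℝ}
    (hc : 0 < c) :
    ∑ s, ∑ t, D s * D t * P.l1Cov s t ≤
      c / 2 + 1 / (2 * c) * (q ^ Fintype.card ι * P.meanChiSq D) := by
  refine le_trans ?_ (add_le_add_right (mul_le_mul_of_nonneg_left
    (hP.sum_sum_l1Cov_sq_le hq h hD) (by positivity)) _)
  have hprod : ∑ x : (ι → V) × (ι → V), D x.1 * D x.2 = 1 := by
    rw [Fintype.sum_prod_type, ← sum_mul_sum, hD1, one_mul]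
  simpa only [Fintype.sum_prod_type] using sum_mul_le_add_mul_sum_mul_sq
    (fun x : (ι → V) × (ι → V) => mul_nonneg (hD x.1) (hD x.2)) hprod hc fun x => P.l1Cov x.1 x.2

end IndependentTuples

section Walks

variable [Fintype V] {k : ℕ} {G : WeightedGraph V} {γ : ℝ}

theorem sum_walkDist_sum_stationary_l2Cov_le (hP : P.IsConsistent (2 * k))
    (hq : P.HasSupportLE q) {j : ℕ} (hj : j + 1 ≤ k) :
    ∑ s, ∑ v, G.walkDist (j + 1) s * G.stationary v * P.l2Cov s (fun _ : Unit => v) ≤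
      q ^ k * P.meanChiSq (G.walkDist k) := by
  have hcard : Fintype.card (Fin k) + Fintype.card (Fin k) ≤ 2 * k := by simp [two_mul]
  have hsq := hP.sum_sum_l1Cov_sq_le hq hcard (D := G.walkDist k) fun w => G.walkDist_nonneg w
  rw [Fintype.card_fin] at hsq
  refine le_trans ?_ hsq
  obtain ⟨l, rfl⟩ : ∃ l, k = l + 1 := ⟨k - 1, by omega⟩
  rw [← G.sum_walkDist_mul_sum_stationary hj]
  gcongr with s _ t _
  · exact mul_nonneg (G.walkDist_nonneg s) (G.walkDist_nonneg t)
  · refine (l2Cov_le_l1Cov_sq _ _).trans (pow_le_pow_left₀ (l1Cov_nonneg _ _) ?_ 2)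
    exact hP.l1Cov_comp_le hcard s t _ fun _ : Unit => Fin.last l

variable [Nonempty V]

theorem sum_walkDist_l2Cov_le (hP : P.IsConsistent (2 * k))
    (hpsd : (P.covMatrix fun S => #S ≤ k).PosSemidef) (hG : G.IsTwoSidedExpander γ) (hγ0 : 0 < γ)
    (hγ : γ < 1) {j : ℕ} (hj : j + 1 ≤ k) :
    ∑ w, G.walkDist (j + 2) w * P.l2Cov (Fin.init w) (fun _ : Unit => w (Fin.last (j + 1))) ≤
      ∑ s, ∑ v, G.walkDist (j + 1) s * G.stationary v * P.l2Cov s (fun _ : Unit => v) + γ := by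
  obtain ⟨N, _, M, hM⟩ := hP.exists_l2Cov_eq_sum_mul hpsd
  have hfin : Fintype.card (Fin (j + 1)) ≤ k := by simpa using hj
  have hunit : Fintype.card Unit ≤ k := by simpa using (Nat.le_add_left 1 j).trans hj
  have hnorm {ι : Type} [Fintype ι] [DecidableEq ι] (hι : Fintype.card ι ≤ k) (f : ι → V) :
      ∑ x, M f x ^ 2 ≤ 1 := by
    simp only [sq, ← hM hι hι]
    exact hP.l2Cov_le_one (by omega) f f
  simp only [hM hfin hunit]
  exact hG.sum_walkDist_sum_mul_le hγ0 hγ (fun s => hnorm hfin s) fun v => hnorm hunit fun _ => v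

theorem sum_walkDist_l1Cov_le (hP : P.IsConsistent (2 * k))
    (hpsd : (P.covMatrix fun S => #S ≤ k).PosSemidef) (hq : P.HasSupportLE q)
    (hG : G.IsTwoSidedExpander γ) (hγ0 : 0 < γ) (hγ : γ < 1) {j : ℕ} (hj : j + 2 ≤ k) {c : ℝ}
    (hc : 0 < c) :
    ∑ w, G.walkDist (j + 2) w * P.l1Cov (Fin.init w) (fun _ : Unit => w (Fin.last (j + 1))) ≤
      c / 2 + 1 / (2 * c) * (q ^ k * (q ^ k * P.meanChiSq (G.walkDist k) + γ)) := by
  have hq1 : (1 : ℝ) ≤ q := mod_cast hP.one_le_of_hasSupportLE (by omega) hq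
  have hl2 := (hP.sum_walkDist_l2Cov_le hpsd hG hγ0 hγ (j := j) (by omega)).trans
    (add_le_add_left (hP.sum_walkDist_sum_stationary_l2Cov_le (G := G) hq (by omega)) γ)
  have hsq : ∑ w, G.walkDist (j + 2) w *
      P.l1Cov (Fin.init w) (fun _ : Unit => w (Fin.last (j + 1))) ^ 2 ≤
        q ^ k * (q ^ k * P.meanChiSq (G.walkDist k) + γ) := by
    refine le_trans ?_ (mul_le_mul_of_nonneg_left hl2 (by positivity))
    simp only [mul_sum, mul_left_comm ((q : ℝ) ^ k)]
    gcongr with w _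
    · exact G.walkDist_nonneg w
    · refine (hP.l1Cov_sq_le_l2Cov hq (by simp; omega) _ _).trans
        (mul_le_mul_of_nonneg_right (pow_le_pow_right₀ hq1 (by simp; omega)) ?_)
      exact sum_nonneg fun _ _ => sum_nonneg fun _ _ => sq_nonneg _
  refine (sum_mul_le_add_mul_sum_mul_sq (fun w => G.walkDist_nonneg w) (G.sum_walkDist _)
    hc _).trans ?_
  gcongr

theorem sum_walkDist_prodDist_le (hP : P.IsConsistent (2 * k))
    (hpsd : (P.covMatrix fun S => #S ≤ k).PosSemidef) (hq : P.HasSupportLE q)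
    (hG : G.IsTwoSidedExpander γ) (hγ0 : 0 < γ) (hγ : γ < 1) {c : ℝ} (hc : 0 < c) {j : ℕ}
    (hj : j + 1 ≤ k) :
    ∑ w, G.walkDist (j + 1) w * P.prodDist w ≤
      j * (c / 2 + 1 / (2 * c) * (q ^ k * (q ^ k * P.meanChiSq (G.walkDist k) + γ))) := by
  induction j with
  | zero => simp [hP.prodDist_eq_zero_of_unique (by omega : 1 ≤ 2 * k)]
  | succ j ih =>
    have hinit := ih (by omega)
    have hlast := hP.sum_walkDist_l1Cov_le hpsd hq hG hγ0 hγ hj hc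
    rw [← G.sum_walkDist_init] at hinit
    calc ∑ w, G.walkDist (j + 2) w * P.prodDist w
        ≤ ∑ w, G.walkDist (j + 2) w *
            (P.l1Cov (Fin.init w) (fun _ : Unit => w (Fin.last (j + 1))) +
              P.prodDist (Fin.init w)) :=
          sum_le_sum fun w _ => mul_le_mul_of_nonneg_left (hP.prodDist_le (by omega) w)
            (G.walkDist_nonneg w)
      _ ≤ _ := by
          simp only [mul_add (G.walkDist _ _), sum_add_distrib]
          push_cast
          linarith

end Walks

end IsConsistent

end LocalFamily

namespace LocalPSDEnsemble

open Finset

variable {V A : Type} [Fintype V] [DecidableEq V] [Fintype A] [DecidableEq A] {L k q : ℕ}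
  (Z : LocalPSDEnsemble V A (L + 2 * k)) {T : Finset V} {σ : T → A}

theorem cond_isConsistent (hT : #T ≤ L) (hσ : 0 < Z.prob T σ) :
    (Z.prob.cond T σ).IsConsistent (2 * k) :=
  Z.isConsistent.cond_isConsistent (by omega) hσ

theorem cond_posSemidef (hk : 1 ≤ k) (hT : #T ≤ L) (hσ : 0 < Z.prob T σ) :
    ((Z.prob.cond T σ).covMatrix fun S => #S ≤ k).PosSemidef :=
  LocalFamily.covMatrix_posSemidef_mono (fun S hS => by omega) (Z.posSemidef T σ (by omega) hσ)

theorem cond_hasSupportLE (hk : 1 ≤ k) (hq : Z.SupportLE q) (hT : #T ≤ L)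
    (hσ : 0 < Z.prob T σ) : (Z.prob.cond T σ).HasSupportLE q := by
  intro v
  refine (card_le_card fun a ha => ?_).trans (hq v)
  simp only [mem_filter, mem_univ, true_and] at ha ⊢
  contrapose! ha
  have hcard : Fintype.card Unit + #T ≤ L + 2 * k := by simp; omega
  have hcard' : Fintype.card Unit + Fintype.card T ≤ L + 2 * k := by simpa using hcard
  have hle := Z.isConsistent.joint_le_left hcard' (fun _ => v) Subtype.val (fun _ => a) σ
  have hge := Z.isConsistent.joint_nonneg hcard' (fun _ => v) Subtype.val (fun _ => a) σ
  rw [Z.isConsistent.tuple_const (by omega), ha] at hle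
  rw [← (Z.cond_isConsistent hT hσ).tuple_const (ι := Unit) (by omega),
    Z.isConsistent.cond_tuple hcard, le_antisymm hle hge, zero_div]

end LocalPSDEnsemble

theorem half_add_mul_le {c x : ℝ} (hc : 0 < c) (hx : x ≤ c ^ 2) : c / 2 + 1 / (2 * c) * x ≤ c :=
  calc c / 2 + 1 / (2 * c) * x ≤ c / 2 + 1 / (2 * c) * c ^ 2 := by gcongr
    _ = c := by field_simp; norm_num

theorem le_of_two_mul_div_le {k L : ℕ} {ε : ℝ} (hε0 : 0 < ε) (hε1 : ε ≤ 1) (h : 2 * k / ε ≤ L) :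
    k ≤ L := by
  have hkε : 2 * (k : ℝ) ≤ 2 * k / ε := le_div_self (by positivity) hε0 hε1
  have hkL : (k : ℝ) ≤ L := by linarith [k.cast_nonneg (α := ℝ)]
  exact_mod_cast hkL

theorem one_div_natDiv_le {k L : ℕ} {ε : ℝ} (hk : 1 ≤ k) (hkL : k ≤ L) (hε : 0 < ε)
    (h : 2 * k / ε ≤ L) : 1 / ((L / k : ℕ) : ℝ) ≤ ε := by
  have hdiv : 1 ≤ L / k := Nat.div_pos hkL hk
  have hL : L ≤ 2 * k * (L / k) := by
    have hmod := Nat.div_add_mod L k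
    have hlt := Nat.mod_lt L hk
    nlinarith
  have hk0 : (0 : ℝ) < 2 * k := by positivity
  have hLk : 2 * k * (1 / ε) ≤ 2 * k * ((L / k : ℕ) : ℝ) := by
    rw [mul_one_div]
    exact h.trans (mod_cast hL)
  exact (one_div_le hε (by positivity)).1 (le_of_mul_le_mul_left hLk hk0)

namespace LocalPSDEnsemble

variable {V A : Type} [Fintype V] [DecidableEq V] [Fintype A] [DecidableEq A] {L k q : ℕ}
  (Z : LocalPSDEnsemble V A (L + 2 * k)) {c : ℝ}

theorem sliceExpectation_l1Cov_le (hk : 1 ≤ k) (hkL : k ≤ L) (hZ : Z.SupportLE q)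
    {D : (Fin k → V) → ℝ} (hD : ∀ w, 0 ≤ D w) (hD1 : ∑ w, D w = 1) (hc : 0 < c)
    (h : (q : ℝ) ^ k * (1 / (L / k : ℕ)) ≤ c ^ 2) :
    Z.sliceExpectation D L (fun P => ∑ s, ∑ t, D s * D t * P.l1Cov s t) ≤ c := by
  refine (Z.sliceExpectation_le_add_mul hk hkL (by omega) hD hD1
    (F' := fun P => P.meanChiSq D) (a := c / 2) (b := 1 / (2 * c) * q ^ k)
    fun T σ hT hσ => ?_).trans ?_
  · have hT' := (Z.cond_isConsistent hT hσ).sum_sum_l1Cov_le (Z.cond_hasSupportLE hk hZ hT hσ)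
      (by simp [two_mul]) hD hD1 hc
    rwa [Fintype.card_fin, ← mul_assoc] at hT'
  · rw [mul_assoc]
    refine half_add_mul_le hc (le_trans ?_ h)
    gcongr
    exact Z.sliceExpectation_meanChiSq_le le_rfl hD hD1

theorem sliceExpectation_prodDist_le [Nonempty V] {G : WeightedGraph V} {γ : ℝ} (hk : 1 ≤ k)
    (hkL : k ≤ L) (hZ : Z.SupportLE q) (hG : G.IsTwoSidedExpander γ) (hγ0 : 0 < γ) (hγ : γ < 1)
    (hc : 0 < c) (h : (q : ℝ) ^ k * (q ^ k * (1 / (L / k : ℕ)) + γ) ≤ c ^ 2) :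
    Z.sliceExpectation (G.walkDist k) L (fun P => ∑ w, G.walkDist k w * P.prodDist w) ≤
      k * c := by
  obtain ⟨j, rfl⟩ : ∃ j, k = j + 1 := ⟨k - 1, by omega⟩
  have hD (w : Fin (j + 1) → V) := G.walkDist_nonneg w
  have hD1 := G.sum_walkDist (j + 1)
  refine (Z.sliceExpectation_le_add_mul hk hkL (by omega) hD hD1
    (F' := fun P => P.meanChiSq (G.walkDist (j + 1)))
    (a := j * (c / 2 + 1 / (2 * c) * (q ^ (j + 1) * γ)))
    (b := j * (1 / (2 * c) * (q ^ (j + 1) * q ^ (j + 1)))) fun T σ hT hσ => ?_).trans ?_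
  · refine ((Z.cond_isConsistent hT hσ).sum_walkDist_prodDist_le (Z.cond_posSemidef hk hT hσ)
      (Z.cond_hasSupportLE hk hZ hT hσ) hG hγ0 hγ hc le_rfl).trans_eq ?_
    ring
  · have hmean := Z.sliceExpectation_meanChiSq_le le_rfl hD hD1
    calc _ = j * (c / 2 + 1 / (2 * c) * (q ^ (j + 1) * (q ^ (j + 1) *
            Z.sliceExpectation (G.walkDist (j + 1)) L (fun P => P.meanChiSq (G.walkDist (j + 1))) +
              γ))) := by
          ring
      _ ≤ j * (c / 2 + 1 / (2 * c) *
            (q ^ (j + 1) * (q ^ (j + 1) * (1 / (L / (j + 1) : ℕ)) + γ))) := by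
          gcongr
      _ ≤ (j + 1 : ℕ) * c :=
          mul_le_mul (by simp) (half_add_mul_le hc h) (by positivity) (by positivity)

end LocalPSDEnsemble

theorem mainTheorem9_general {V A : Type} [Fintype V] [DecidableEq V] [Nonempty V] [Fintype A]
    [DecidableEq A] {G : WeightedGraph V} {k q L : ℕ} {μ γ : ℝ} (hk : 1 ≤ k) (hμ : 0 < μ)
    (hμ1 : μ ≤ 1) (hL : 4 * ((q : ℝ) ^ (2 * k) * k ^ 3 / μ ^ 2) ≤ L) (hG : G.IsTwoSidedExpander γ)
    (hγ : γ ≤ μ ^ 2 / (2 * k ^ 2 * q ^ k)) (Z : LocalPSDEnsemble V A (L + 2 * k))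
    (hZ : Z.SupportLE q) : Z.IsTwoStepTensorial (G.walkDist k) μ := by
  have hk' : (1 : ℝ) ≤ k := mod_cast hk
  have hq : (1 : ℝ) ≤ q := mod_cast Z.isConsistent.one_le_of_hasSupportLE (by omega) hZ
  have hQ : 1 ≤ (q : ℝ) ^ k := one_le_pow₀ hq
  obtain ⟨ε, hε⟩ : ∃ ε, ε = μ ^ 2 / (2 * k ^ 2 * (q ^ k) ^ 2) := ⟨_, rfl⟩
  have hε0 : 0 < ε := by rw [hε]; positivity
  have hLε : 2 * k / ε ≤ L := by convert hL using 1; rw [hε]; field_simp; ring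
  have hγε : μ ^ 2 / (2 * k ^ 2 * q ^ k) = q ^ k * ε := by rw [hε]; field_simp
  have hsq : q ^ k * (q ^ k * ε + q ^ k * ε) = (μ / k) ^ 2 := by rw [hε]; field_simp; norm_num
  have hγμ : q ^ k * ε ≤ μ ^ 2 / 2 := by
    rw [← hγε]
    gcongr
    nlinarith [one_le_mul_of_one_le_of_one_le (one_le_pow₀ hk' : 1 ≤ (k : ℝ) ^ 2) hQ]
  have hμ2 : μ ^ 2 ≤ 1 := pow_le_one₀ hμ.le hμ1
  have hεQ : ε ≤ q ^ k * ε := le_mul_of_one_le_left hε0.le hQ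
  have hkL := le_of_two_mul_div_le hε0 (by linarith) hLε
  have hdiv := one_div_natDiv_le hk hkL hε0 hLε
  have hwalk : (q : ℝ) ^ k * (q ^ k * (1 / (L / k : ℕ)) + q ^ k * ε) ≤ (μ / k) ^ 2 := by
    rw [← hsq]; gcongr
  have hpair : (q : ℝ) ^ k * (1 / (L / k : ℕ)) ≤ μ ^ 2 := by
    have hdivQ := mul_le_mul_of_nonneg_left hdiv (zero_le_one.trans hQ)
    linarith
  have hGε : G.IsTwoSidedExpander (q ^ k * ε) := fun i hi => (hG i hi).trans (hγ.trans_eq hγε)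
  refine ⟨⟨hkL, (Z.sliceExpectation_prodDist_le hk hkL hZ hGε (by positivity) (by linarith)
    (by positivity) hwalk).trans_eq (mul_div_cancel₀ μ (by positivity))⟩, ?_⟩
  exact Z.sliceExpectation_l1Cov_le hk hkL hZ (fun w => G.walkDist_nonneg w) (G.sum_walkDist k)
    hμ hpair

theorem mainTheorem9 :
    ∃ c' : ℝ, 0 < c' ∧ ∃ C' : ℝ, 0 < C' ∧
      ∀ (V A : Type) [Fintype V] [DecidableEq V] [Nonempty V] [Fintype A] [DecidableEq A]
        (G : WeightedGraph V) (k q L : ℕ) (μ γ : ℝ),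
        1 ≤ k → 0 < μ → μ ≤ 1 →
        c' * ((q : ℝ) ^ (4 * k) * (k : ℝ) ^ 7 / μ ^ 5) ≤ (L : ℝ) →
        G.IsTwoSidedExpander γ →
        γ ≤ C' * μ ^ 2 / ((k : ℝ) ^ 2 * (q : ℝ) ^ (2 * k)) →
        ∀ Z : LocalPSDEnsemble V A (L + 2 * k), Z.SupportLE q →
          Z.IsTwoStepTensorial (G.walkDist k) μ := by
  refine ⟨4, by norm_num, 1 / 2, by norm_num, ?_⟩
  intro V A _ _ _ _ _ G k q L μ γ hk hμ hμ1 hL hG hγ Z hZ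
  have hk' : (1 : ℝ) ≤ k := mod_cast hk
  have hq : (1 : ℝ) ≤ q := mod_cast Z.isConsistent.one_le_of_hasSupportLE (by omega) hZ
  refine mainTheorem9_general hk hμ hμ1 (le_trans ?_ hL) hG (hγ.trans ?_) Z hZ
  · gcongr ?_ * (?_ / ?_)
    · gcongr <;> omega
    · exact pow_le_pow_of_le_one hμ.le hμ1 (by norm_num)
  · rw [one_div_mul_eq_div, div_div, ← mul_assoc]
    gcongr
    omega
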